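/- Let $n$ be a positive integer, let $\alpha=(\alpha_1,\dots,\alpha_m)$ be a composition of $n$ (positive integers with sum $n$), and let $r\ge 1$ be an integer. Write every set partition of $[n]=\{1,\dots,n\}$ as $B_1/B_2/\cdots/B_m$ with $\max B_1<\max B_2<\cdots<\max B_m$ and with the elements of each block listed increasingly; its shape is $(|B_1|,\dots,|B_m|)$. Let $\mathcal P_\alpha^{\mathrm{perm}}\subseteq\mathfrak S_n$ be the set of permutations $\pi=\pi_1\pi_2\cdots\pi_n$ of $[n]$ (in one-line notation) obtained by erasing the bars from the set partitions of $[n]$ of shape $\alpha$. For a permutation $w=w_1w_2\cdots w_n$ of $[n]$, let $\mathsf{inv}(w)$ be the number of pairs $i<j$ with $w_i>w_j$; let $\mathsf{maj}(w)=\sum_{w_i>w_{i+1}} i$; let $$\mathsf{inv}_r(w)=|\{(i,j): i<j<i+r,\ w_i>w_j\}|+\sum_{w_i>w_{i+r}} i;$$ let $\mathsf{lrmax}(w)$ be the number of $i$ with $w_j<w_i$ for all $j<i$; and let $$\mathsf{mak}(w)=\sum_{i\,:\,w_i>w_{i+1}} w_{i+1}+\sum_{i=1}^n e_i,$$ where $e_i$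 is the number of maximal strictly decreasing contiguous subwords $w_aw_{a+1}\cdots w_b$ of $w$ with $i<a<b$ and $w_a\ge w_i>w_b$. Put $\mathsf{imaj}(\pi)=\mathsf{maj}(\pi^{-1})$, $\mathsf{imak}(\pi)=\mathsf{mak}(\pi^{-1})$ and $\mathsf{iinv}_r(\pi)=\mathsf{inv}_r(\pi^{-1})$. Then, as polynomials in $q$, $$\sum_{\pi\in\mathcal P_\alpha^{\mathrm{perm}}}q^{\mathsf{inv}(\pi)}=\sum_{\pi\in\mathcal P_\alpha^{\mathrm{perm}}}q^{\mathsf{imaj}(\pi)}=\sum_{\pi\in\mathcal P_\alpha^{\mathrm{perm}}}q^{\mathsf{imak}(\pi)}=\sum_{\pi\in\mathcal P_\alpha^{\mathrm{perm}}}q^{\mathsf{iinv}_r(\pi)},$$ and, as polynomials in $q$ and $x$, $$\sum_{\pi\in\mathcal P_\alpha^{\mathrm{perm}}}q^{\mathsf{inv}(\pi)}x^{\mathsf{lrmax}(\pi)}=\sum_{\pi\in\mathcal P_\alpha^{\mathrm{perm}}}q^{\mathsf{imaj}(\pi)}x^{\mathsf{lrmax}(\pi)}=\sum_{\pi\in\mathcal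 P_\alpha^{\mathrm{perm}}}q^{\mathsf{imak}(\pi)}x^{\mathsf{lrmax}(\pi)}=\sum_{\pi\in\mathcal P_\alpha^{\mathrm{perm}}}q^{\mathsf{iinv}_r(\pi)}x^{\mathsf{lrmax}(\pi)}.$$ -/

import Mathlib

namespace SetPartPerm

/-! ### Statistics on words

A word `w₁ w₂ … wₙ` over a linearly ordered alphabet is a function `w : Fin n → β`; the position
written `i + 1` in one-based notation is the element `i : Fin n`. -/

section Words

variable {β : Type*} [LinearOrder β] {n : ℕ}

/-- `inv w`: the number of pairs of positions `i < j` with `w i > w j`. -/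
def inv (w : Fin n → β) : ℕ :=
  (Finset.univ.filter fun p : Fin n × Fin n => p.1 < p.2 ∧ w p.2 < w p.1).card

/-- The position `i` is a descent of `w`: it is not the last one and the next letter is smaller. -/
def IsDescent (w : Fin n → β) (i : Fin n) : Prop :=
  ∃ j : Fin n, (j : ℕ) = (i : ℕ) + 1 ∧ w j < w i

/-- The letter at position `j` is a descent bottom of `w`: it is not the first one and the previous
letter is larger. -/
def IsDescentBottom (w : Fin n → β) (j : Fin n) : Prop :=
  ∃ i : Fin n, (j : ℕ) = (i : ℕ) + 1 ∧ w j < w i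

instance (w : Fin n → β) : DecidablePred (IsDescent w) := fun i =>
  inferInstanceAs (Decidable (∃ j : Fin n, (j : ℕ) = (i : ℕ) + 1 ∧ w j < w i))

instance (w : Fin n → β) : DecidablePred (IsDescentBottom w) := fun j =>
  inferInstanceAs (Decidable (∃ i : Fin n, (j : ℕ) = (i : ℕ) + 1 ∧ w j < w i))

/-- The major index: the sum of the (one-based) descents of `w`. -/
def maj (w : Fin n → β) : ℕ :=
  ∑ i ∈ Finset.univ.filter (IsDescent w), ((i : ℕ) + 1)

/-- Kadell's statistic `inv_r`: the number of inversions `(i, j)` with `i < j < i + r`, plus the sum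
of the (one-based) positions `i` with `w i > w (i + r)`. -/
def invr (r : ℕ) (w : Fin n → β) : ℕ :=
  (Finset.univ.filter fun p : Fin n × Fin n =>
      p.1 < p.2 ∧ (p.2 : ℕ) < (p.1 : ℕ) + r ∧ w p.2 < w p.1).card
    + ∑ i ∈ Finset.univ.filter
        (fun i : Fin n => ∃ j : Fin n, (j : ℕ) = (i : ℕ) + r ∧ w j < w i), ((i : ℕ) + 1)

/-- The value of the `i`-th letter: its height (one more than the number of strictly smaller letters
of `w`) plus the number of equal letters to its left. -/
def value (w : Fin n → β) (i : Fin n) : ℕ :=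
  ((Finset.univ.filter fun j => w j < w i).card + 1)
    + (Finset.univ.filter fun j => j < i ∧ w j = w i).card

/-- The descent bottoms sum: the sum of the values of the descent bottoms. -/
def Dbot (w : Fin n → β) : ℕ :=
  ∑ j ∈ Finset.univ.filter (IsDescentBottom w), value w j

/-- The positions `a, a + 1, …, b` carry a proper descent block of `w`, that is, a maximal run of
consecutive strictly decreasing letters, with at least two letters. Its closer is the letter `w a`
and its opener is the letter `w b`. -/
def IsProperDescentBlock (w : Fin n → β) (a b : Fin n) : Prop :=
  a < b ∧ (∀ i, a ≤ i → i < b → IsDescent w i) ∧ ¬ IsDescentBottom w a ∧ ¬ IsDescent w b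

instance (w : Fin n → β) (a b : Fin n) : Decidable (IsProperDescentBlock w a b) :=
  inferInstanceAs (Decidable (a < b ∧ (∀ i, a ≤ i → i < b → IsDescent w i) ∧
    ¬ IsDescentBottom w a ∧ ¬ IsDescent w b))

/-- The embracing number of the `i`-th letter: the number of proper descent blocks `B` strictly to
the right of it with `closer B ≥ w i > opener B`. -/
def embracing (w : Fin n → β) (i : Fin n) : ℕ :=
  (Finset.univ.filter fun p : Fin n × Fin n =>
    IsProperDescentBlock w p.1 p.2 ∧ i < p.1 ∧ w i ≤ w p.1 ∧ w p.2 < w i).card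

/-- The embracing sum. -/
def Res (w : Fin n → β) : ℕ := ∑ i, embracing w i

/-- The statistic `mak`. -/
def mak (w : Fin n → β) : ℕ := Dbot w + Res w

/-- The number of left-to-right maxima. -/
def lrmax (w : Fin n → β) : ℕ :=
  (Finset.univ.filter fun i => ∀ j, j < i → w j < w i).card

end Words

/-! ### Statistics on permutations: `ist π = st π⁻¹` -/

/-- `imaj π = maj π⁻¹`. -/
def imaj {n : ℕ} (π : Equiv.Perm (Fin n)) : ℕ := maj ⇑π⁻¹

/-- `imak π = mak π⁻¹`. -/
def imak {n : ℕ} (π : Equiv.Perm (Fin n)) : ℕ := mak ⇑π⁻¹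

/-- `iinv_r π = inv_r π⁻¹`. -/
def iinvr {n : ℕ} (r : ℕ) (π : Equiv.Perm (Fin n)) : ℕ := invr r ⇑π⁻¹

/-! ### Set partitions, with the blocks ordered by their maxima -/

/-- The blocks `B₁, B₂, …, Bₘ` of a set partition, listed so that `max B₁ < max B₂ < ⋯ < max Bₘ`:
run in increasing order through the elements that are the largest of their block, and list their
blocks. -/
def blocks {n : ℕ} (σ : Finpartition (Finset.univ : Finset (Fin n))) : List (Finset (Fin n)) :=
  ((List.finRange n).filter fun i => ∀ j ∈ σ.part i, j ≤ i).map σ.part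

/-- The shape `(|B₁|, |B₂|, …, |Bₘ|)`. -/
def shape {n : ℕ} (σ : Finpartition (Finset.univ : Finset (Fin n))) : List ℕ :=
  (blocks σ).map Finset.card

/-- The word obtained from `B₁ / B₂ / ⋯ / Bₘ`, with each block written increasingly, by erasing
the bars. -/
def eraseBars {n : ℕ} (σ : Finpartition (Finset.univ : Finset (Fin n))) : List (Fin n) :=
  ((blocks σ).map fun B => B.sort (· ≤ ·)).flatten

open Classical in
/-- The set of the permutations whose one-line word `π₁ π₂ … πₙ` is obtained by erasing the bars of
a set partition of shape `α`. -/
noncomputable def Pperm {n : ℕ} (α : Composition n) : Finset (Equiv.Perm (Fin n)) :=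
  Finset.univ.filter fun π =>
    ∃ σ : Finpartition (Finset.univ : Finset (Fin n)), shape σ = α.blocks ∧
      List.ofFn ⇑π = eraseBars σ

/-- The generating polynomial `∑_{π ∈ Pperm α} q ^ (st π)`. -/
noncomputable def genPoly {n : ℕ} (α : Composition n) (st : Equiv.Perm (Fin n) → ℕ) :
    Polynomial ℤ :=
  ∑ π ∈ Pperm α, Polynomial.X ^ st π

/-- The generating polynomial `∑_{π ∈ Pperm α} q ^ (st π) * x ^ (lrmax π)` in two variables `q`
and `x`. -/
noncomputable def genPolyLrmax {n : ℕ} (α : Composition n) (st : Equiv.Perm (Fin n) → ℕ) :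
    MvPolynomial (Fin 2) ℤ :=
  ∑ π ∈ Pperm α, MvPolynomial.X 0 ^ st π * MvPolynomial.X 1 ^ lrmax ⇑π

end SetPartPerm

/-!
Write `w = π⁻¹`. The statistics in question, other than `lrmax`, are statistics of `w` (and
`inv π = inv w`), and membership in `Pperm α` is a condition on `w` as well (`mem_Pperm_iff_adm`):
if `i` and `i + 1` are positions of `π` in the same block, then the letter `i` precedes the letter
`i + 1` in `w`, and if `e` is the last position of a block, then all letters `i < e` precede `e`
in `w` (`Adm`). Likewise `lrmax π` is the number of letters of `w` that are preceded by all
smaller letters.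

*`inv` and `inv_r`.* Kadell's bijection, a generalization of Foata's, carries `inv_r` to `inv`
(`revInv_kadell`). It is composed of rotations that depend on a letter `x` and keep the relative
order of two letters `≤ x` and of two letters `> x`. Hence it keeps the relative order of the
letters `i` and `i + 1`, and it keeps the property of a letter to be preceded by all smaller ones
(`kadellWord_consecutive`, `kadellWord_minimum`). So it permutes the admissible words and
preserves `lrmax`, which gives `sum_revInv_eq_sum_revInvr`. The major index is `inv_1`.

*`inv` and `mak`.* By `mak_eq_sum`, `mak` of a permutation is a sum over its descents, and the
contribution of a descent with top `b` and bottom `a` is one more than the number of letters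
smaller than `b` in front of `a` plus the number of letters smaller than `a` behind `a`. The word
`w` is built by inserting the letters `0, 1, …, n - 1` one after the other. In order to see the
effect of each insertion on `mak`, decide in advance at which places larger letters will be
inserted later: a mark on a letter announces that a larger letter will come directly in front of
it. Insertions take place in front of marked letters or at the end, and the increase of `mak`
depends only on the number of marks behind the new letter and on the new marks (`markedMak_mid`,
`markedMak_final`). Words without marks at the end give `mak`. The same scheme, restricted to
words all whose letters are marked, describes `inv`.

Admissibility says that within a block each letter is inserted to the right of the previous one,
and that the last letter of a block is inserted at the end. So the generating functions are
iterated sums `run` over states that consist of two numbers, the number of marks up to the last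
insertion and the number of marks behind it. Over a block, of `c + 1` letters after `N` letters,
the sum for `inv` acquires the factor `blockCoeff q x c N`. For `mak`, the sum over the
`q`-weighted arrangements of marks acquires the same factor, by a `q`-Vandermonde identity
(`markSum_blockVal`). Both generating functions are therefore the product of these factors over
the blocks (`exists_run_eq`).
-/

namespace SetPartPerm

/-! ### Weights of insertions and a `q`-Vandermonde identity -/

section Algebra

variable {R : Type*} [CommRing R]

/-- The linear functional `f ↦ ∑ j, q ^ (j (j + 1) / 2) [N choose j]_q f j`, in the form of the
`q`-Pascal recursion. -/
def markSum (q : R) : ℕ → (ℕ → R) → R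
  | 0, f => f 0
  | N + 1, f => markSum q N fun j => f j + q ^ (N + 1) * f (j + 1)

theorem markSum_add (q : R) (N : ℕ) (f g : ℕ → R) :
    markSum q N (fun j => f j + g j) = markSum q N f + markSum q N g := by
  induction N generalizing f g with
  | zero => rfl
  | succ N ih =>
    simp only [markSum]
    rw [← ih]
    congr 1; funext j; ring

theorem markSum_mul (q : R) (N : ℕ) (y : R) (f : ℕ → R) :
    markSum q N (fun j => y * f j) = y * markSum q N f := by
  induction N generalizing f with
  | zero => rfl
  | succ N ih =>
    simp only [markSum]
    rw [← ih]
    congr 1; funext j; ring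

/-- The second `q`-Pascal recursion. -/
theorem markSum_succ' (q : R) (N : ℕ) (f : ℕ → R) :
    markSum q (N + 1) f = markSum q N fun j => q ^ j * f j + q ^ (j + 1) * f (j + 1) := by
  induction N generalizing f with
  | zero => simp [markSum]
  | succ N ih =>
    rw [markSum, ih, markSum]
    congr 1; funext j; ring

theorem markSum_delta (q : R) (N : ℕ) :
    markSum q N (fun j => if j = 0 then 1 else 0) = 1 := by
  induction N with
  | zero => simp [markSum]
  | succ N ih => simpa [markSum] using ih

/-- The operators of `markSum` for the indices `N + 1, …, N + c`. -/
def markOps (q : R) : ℕ → ℕ → (ℕ → R) → ℕ → R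
  | _, 0, f => f
  | N, c + 1, f => fun j => markOps q (N + 1) c f j + q ^ (N + 1) * markOps q (N + 1) c f (j + 1)

theorem markSum_markOps (q : R) (N c : ℕ) (f : ℕ → R) :
    markSum q N (markOps q N c f) = markSum q (N + c) f := by
  induction c generalizing N with
  | zero => rfl
  | succ c ih =>
    rw [show N + (c + 1) = N + 1 + c by ring, ← ih (N + 1)]
    rfl

/-- The total weight of the ways to insert the `c + 1` letters of a block, each to the right of the
one before and the last of them at the end, into a word with `g` marks that are out of reach and
`p` marks that can be used, when the marks put on the new letters are disregarded: an arrangement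
that leaves `j` of the marks counts with the factor `φ j`. -/
def blockVal (q x : R) : ℕ → (ℕ → R) → ℕ → ℕ → R
  | 0, φ, g, p => x * φ (g + p)
  | c + 1, φ, g, 0 => x * blockVal q x c φ g 0
  | c + 1, φ, g, p + 1 => blockVal q x (c + 1) φ (g + 1) p
      + q ^ (p + 1) * blockVal q x c φ g (p + 1) + q ^ p * blockVal q x c φ g p

/-- The polynomial `∑ b ≤ c, x ^ (c + 1 - b) h_b(q, q ^ 2, …, q ^ p)`, with `h_b` the complete
homogeneous symmetric polynomials: the contribution of a block of size `c + 1` that follows `p`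
smaller letters. -/
def blockCoeff (q x : R) : ℕ → ℕ → R
  | 0, _ => x
  | c + 1, 0 => x * blockCoeff q x c 0
  | c + 1, p + 1 => blockCoeff q x (c + 1) p + q ^ (p + 1) * blockCoeff q x c (p + 1)

theorem blockVal_succ_succ (q x : R) (c : ℕ) (φ : ℕ → R) (g p : ℕ) :
    blockVal q x (c + 1) φ g (p + 1) = blockVal q x (c + 1) φ (g + 1) p
      + q ^ (p + 1) * blockVal q x c φ g (p + 1) + q ^ p * blockVal q x c φ g p := by
  rw [blockVal]

theorem blockCoeff_succ_succ (q x : R) (c p : ℕ) :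
    blockCoeff q x (c + 1) (p + 1)
      = blockCoeff q x (c + 1) p + q ^ (p + 1) * blockCoeff q x c (p + 1) := by
  rw [blockCoeff]

theorem blockVal_shift (q x : R) (c : ℕ) (φ : ℕ → R) (g p : ℕ) :
    blockVal q x c φ (g + 1) p = blockVal q x c (fun j => φ (j + 1)) g p := by
  induction c generalizing g p with
  | zero => simp only [blockVal]; congr 2; ring
  | succ c ihc =>
    induction p generalizing g with
    | zero => simp only [blockVal, ihc]
    | succ p ihp => simp only [blockVal, ihc, ihp]

theorem blockVal_add (q x : R) (c : ℕ) (φ ψ : ℕ → R) (y : R) (g p : ℕ) :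
    blockVal q x c (fun j => φ j + y * ψ j) g p
      = blockVal q x c φ g p + y * blockVal q x c ψ g p := by
  induction c generalizing g p with
  | zero => simp only [blockVal]; ring
  | succ c ihc =>
    induction p generalizing g with
    | zero => simp only [blockVal, ihc]; ring
    | succ p ihp => simp only [blockVal, ihc, ihp]; ring

/-- The `q`-Vandermonde identity behind the insertion of a block. -/
theorem markSum_blockVal (q x : R) (c N : ℕ) (φ : ℕ → R) :
    markSum q N (fun j => blockVal q x c φ 0 j) = blockCoeff q x c N * markSum q N φ := by
  induction c generalizing N φ with
  | zero => simp [blockVal, blockCoeff, markSum_mul]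
  | succ c ihc =>
    induction N generalizing φ with
    | zero =>
      have := ihc 0 φ
      simp only [markSum] at this
      simp only [markSum, blockVal, blockCoeff, this]; ring
    | succ N ihN =>
      have h1 : ∀ j, blockVal q x (c + 1) φ 0 j + q ^ (N + 1) * blockVal q x (c + 1) φ 0 (j + 1)
          = (blockVal q x (c + 1) φ 0 j
              + q ^ (N + 1) * blockVal q x (c + 1) (fun j => φ (j + 1)) 0 j)
            + q ^ (N + 1) * (q ^ j * blockVal q x c φ 0 j
              + q ^ (j + 1) * blockVal q x c φ 0 (j + 1)) := by
        intro j
        rw [blockVal, blockVal_shift]; ring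
      calc markSum q (N + 1) (fun j => blockVal q x (c + 1) φ 0 j)
          = markSum q N (fun j => blockVal q x (c + 1) φ 0 j
              + q ^ (N + 1) * blockVal q x (c + 1) φ 0 (j + 1)) := rfl
        _ = blockCoeff q x (c + 1) N * markSum q (N + 1) φ
              + q ^ (N + 1) * markSum q (N + 1) (fun j => blockVal q x c φ 0 j) := by
          have h2 : markSum q (N + 1) φ
              = markSum q N φ + q ^ (N + 1) * markSum q N fun j => φ (j + 1) := by
            rw [markSum, markSum_add, markSum_mul]
          simp_rw [h1]
          rw [markSum_add, markSum_add, markSum_mul, markSum_mul, ihN, ihN, ← markSum_succ', h2]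
          ring
        _ = _ := by rw [ihc, blockCoeff]; ring

/-- The total over the insertions of a letter in front of one of the `p` reachable marked letters,
`g` being the number of marks out of reach: an insertion behind which `p'` reachable marked letters
remain has weight `ω d p' c`, where `d` tells whether the new letter is marked and `c`
whether the letter behind it stays marked. -/
def slots (ω : Bool → ℕ → Bool → R) (f : ℕ → ℕ → R) : ℕ → ℕ → R
  | _, 0 => 0
  | g, p + 1 => (∑ d : Bool, ∑ c : Bool, ω d p c * f (g + d.toNat) (p + c.toNat))
      + slots ω f (g + 1) p

/-- The total over the insertions of a letter at the end of a word with `j` marks. -/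
def final (ε : Bool → R) (f : ℕ → ℕ → R) (j : ℕ) : R :=
  ∑ d : Bool, ε d * f (j + d.toNat) 0

open Classical in
/-- The effect of the insertion of the letter `k`, where `T` is the set of the letters that end
a block. After the end of a block all marks are reachable again. -/
noncomputable def step (T : Set ℕ) (ω : Bool → ℕ → Bool → R) (ε : Bool → R) (k : ℕ)
    (f : ℕ → ℕ → R) (g p : ℕ) : R :=
  if k ∈ T then final ε (fun g p => f 0 (g + p)) (g + p)
  else slots ω f g p + final ε f (g + p)

/-- The insertion of the letters `0, …, k - 1` into the empty word. -/
noncomputable def run (T : Set ℕ) (ω : ℕ → Bool → ℕ → Bool → R) (ε : ℕ → Bool → R) :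
    ℕ → (ℕ → ℕ → R) → R
  | 0, f => f 0 0
  | k + 1, f => run T ω ε k (step T (ω k) (ε k) k f)

/-- The change of `q ^ mak` under the insertion of the letter `k` in front of a marked letter. -/
def makSlot (q : R) (k : ℕ) (d : Bool) (p : ℕ) (c : Bool) : R :=
  q ^ (p + c.toNat + d.toNat * (k + 1))

/-- The change of `q ^ mak * x ^ lrmax` under the insertion of the letter `k` at the end. -/
def makFinal (q x : R) (k : ℕ) (d : Bool) : R := x * q ^ (d.toNat * (k + 1))

/-- The change of `q ^ inv` under the insertion of a letter in front of a marked letter, when only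
the words all whose letters are marked are counted. -/
def invSlot (q : R) (_k : ℕ) (d : Bool) (p : ℕ) (c : Bool) : R :=
  if d && c then q ^ (p + 1) else 0

/-- The change of `q ^ inv * x ^ lrmax` under the insertion of a letter at the end, when only
the words all whose letters are marked are counted. -/
def invFinal (x : R) (_k : ℕ) (d : Bool) : R := if d then x else 0

theorem run_mak_block (T : Set ℕ) (q x : R) (c N : ℕ) (f : ℕ → ℕ → R)
    (h : ∀ i < c, N + i ∉ T) (hc : N + c ∈ T) :
    run T (makSlot q) (makFinal q x) (N + c + 1) f
      = run T (makSlot q) (makFinal q x) N (blockVal q x c (markOps q N (c + 1) (f 0))) := by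
  induction c generalizing N with
  | zero =>
    rw [add_zero] at hc
    rw [add_zero, run]
    congr 1; funext g p
    simp [step, hc, final, makFinal, blockVal, markOps]; ring
  | succ c ih =>
    have e : N + (c + 1) = N + 1 + c := by ring
    rw [e] at hc ⊢
    have h' : ∀ i < c, N + 1 + i ∉ T := fun i hi => by
      have := h (i + 1) (by omega)
      rwa [show N + (i + 1) = N + 1 + i by ring] at this
    rw [ih (N + 1) h' hc, run]
    have hN : N ∉ T := by simpa using h 0 (by omega)
    congr 1; funext g p
    rw [step, if_neg hN]
    rw [show markOps q N (c + 1 + 1) (f 0) = fun j => markOps q (N + 1) (c + 1) (f 0) j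
      + q ^ (N + 1) * (fun j => markOps q (N + 1) (c + 1) (f 0) (j + 1)) j from rfl]
    generalize markOps q (N + 1) (c + 1) (f 0) = φ
    have hfin : final (makFinal q x N) (blockVal q x c φ) (g + p) = blockVal q x (c + 1)
        (fun j => φ j + q ^ (N + 1) * (fun j => φ (j + 1)) j) (g + p) 0 := by
      simp [final, makFinal, blockVal, blockVal_add, blockVal_shift]; ring
    rw [hfin]
    clear hfin
    induction p generalizing g with
    | zero => simp [slots]
    | succ p ihp =>
      have := ihp (g + 1)
      rw [show g + 1 + p = g + (p + 1) by ring] at this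
      rw [slots, blockVal_succ_succ, ← this]
      simp only [Fintype.sum_bool, makSlot, Bool.toNat_true, Bool.toNat_false, blockVal_add,
        blockVal_shift]
      ring_nf

theorem run_inv_block (T : Set ℕ) (q x : R) (c N : ℕ) (f : ℕ → ℕ → R)
    (h : ∀ i < c, N + i ∉ T) (hc : N + c ∈ T) :
    run T (invSlot q) (invFinal x) (N + c + 1) f
      = run T (invSlot q) (invFinal x) N
          (fun g p => blockCoeff q x c p * f 0 (g + p + c + 1)) := by
  induction c generalizing N with
  | zero =>
    rw [add_zero] at hc
    rw [add_zero, run]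
    congr 1; funext g p
    simp [step, hc, final, invFinal, blockCoeff]
  | succ c ih =>
    have e : N + (c + 1) = N + 1 + c := by ring
    rw [e] at hc ⊢
    have h' : ∀ i < c, N + 1 + i ∉ T := fun i hi => by
      have := h (i + 1) (by omega)
      rwa [show N + (i + 1) = N + 1 + i by ring] at this
    rw [ih (N + 1) h' hc, run]
    have hN : N ∉ T := by simpa using h 0 (by omega)
    congr 1; funext g p
    rw [step, if_neg hN]
    have hfin : final (invFinal x N) (fun g p => blockCoeff q x c p * f 0 (g + p + c + 1)) (g + p)
        = blockCoeff q x (c + 1) 0 * f 0 (g + p + (c + 1) + 1) := by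
      simp [final, invFinal, blockCoeff, mul_assoc]
      ring_nf
    rw [hfin]
    clear hfin
    induction p generalizing g with
    | zero => simp [slots]
    | succ p ihp =>
      rw [slots, blockCoeff_succ_succ, add_mul,
        show g + (p + 1) + (c + 1) + 1 = g + 1 + p + (c + 1) + 1 by ring, ← ihp (g + 1)]
      simp only [Fintype.sum_bool, invSlot, Bool.toNat_true, Bool.toNat_false]
      simp
      ring_nf

/-- After complete blocks the totals for `mak` and for `inv` are governed by the same product. -/
theorem exists_run_eq (T : Set ℕ) (q x : R) (n : ℕ) (hn : n = 0 ∨ n - 1 ∈ T) :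
    ∃ G : R, ∀ f, run T (makSlot q) (makFinal q x) n f = G * markSum q n (f 0) ∧
      run T (invSlot q) (invFinal x) n f = G * f 0 n := by
  induction n using Nat.strong_induction_on with
  | _ n ih =>
    rcases Nat.eq_zero_or_pos n with rfl | hpos
    · exact ⟨1, fun f => by simp [run, markSum]⟩
    have hT : n - 1 ∈ T := hn.resolve_left hpos.ne'
    obtain ⟨N, c, rfl, hN, hlt⟩ : ∃ N c, n = N + c + 1 ∧ (N = 0 ∨ N - 1 ∈ T) ∧
        ∀ i < c, N + i ∉ T := by
      classical
      have key : ∀ c, c + 1 ≤ n → (∀ i < c, n - 2 - i ∉ T) → ∃ N c, n = N + c + 1 ∧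
          (N = 0 ∨ N - 1 ∈ T) ∧ ∀ i < c, N + i ∉ T := by
        intro c hc hi
        induction hd : n - c using Nat.strong_induction_on generalizing c with
        | _ d ihd =>
          by_cases hs : n = c + 1 ∨ n - 2 - c ∈ T
          · refine ⟨n - 1 - c, c, by omega, ?_, fun i hic => ?_⟩
            · rcases hs with hs | hs
              · left; omega
              · right; rwa [show n - 1 - c - 1 = n - 2 - c by omega]
            · have := hi (c - 1 - i) (by omega)
              rwa [show n - 1 - c + i = n - 2 - (c - 1 - i) by omega]
          · push Not at hs
            refine ihd (n - (c + 1)) (by omega) (c + 1) (by omega) (fun i hic => ?_) rfl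
            rcases Nat.lt_succ_iff_lt_or_eq.1 hic with h | rfl
            · exact hi i h
            · exact hs.2
      exact key 0 (by omega) (by simp)
    obtain ⟨G, hG⟩ := ih N (by omega) hN
    refine ⟨G * blockCoeff q x c N, fun f => ?_⟩
    rw [run_mak_block T q x c N f hlt (by simpa using hT),
      run_inv_block T q x c N f hlt (by simpa using hT), (hG _).1, (hG _).2, markSum_blockVal,
      markSum_markOps]
    refine ⟨by rw [mul_assoc]; rfl, by simp [mul_assoc]⟩

end Algebra

/-! ### Marked words -/

section MarkedWords

/-- The underlying word. -/
def letters (v : List (ℕ × Bool)) : List ℕ := v.map Prod.fst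

/-- The number of marked letters. -/
def marks (v : List (ℕ × Bool)) : ℕ := v.countP fun p => p.2

@[simp] theorem letters_nil : letters [] = [] := rfl
@[simp] theorem letters_cons (p : ℕ × Bool) (v) : letters (p :: v) = p.1 :: letters v := rfl
@[simp] theorem letters_append (u v) : letters (u ++ v) = letters u ++ letters v :=
  List.map_append
@[simp] theorem marks_nil : marks [] = 0 := rfl
@[simp] theorem marks_cons (a : ℕ) (m : Bool) (v) : marks ((a, m) :: v) = marks v + m.toNat := by
  cases m <;> simp [marks]
@[simp] theorem marks_append (u v) : marks (u ++ v) = marks u + marks v :=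
  List.countP_append

/-- The results of the insertion of the letter `k` in front of a marked letter. -/
def mid (k : ℕ) : List (ℕ × Bool) → List (List (ℕ × Bool))
  | [] => []
  | (a, m) :: B =>
    (if m then [(k, true) :: (a, true) :: B, (k, true) :: (a, false) :: B,
      (k, false) :: (a, true) :: B, (k, false) :: (a, false) :: B] else [])
    ++ (mid k B).map ((a, m) :: ·)

/-- The results of the insertion of the letter `k` in front of a marked letter or at the end. -/
def ins (k : ℕ) (v : List (ℕ × Bool)) : List (List (ℕ × Bool)) :=
  mid k v ++ [v ++ [(k, true)], v ++ [(k, false)]]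

/-- All marked words whose letters are `0, …, k - 1`, each once. -/
def markedWords : ℕ → List (List (ℕ × Bool))
  | 0 => [[]]
  | k + 1 => (markedWords k).flatMap (ins k)

theorem mem_mid {k : ℕ} {v u : List (ℕ × Bool)} : u ∈ mid k v ↔
    ∃ A a B d c, v = A ++ (a, true) :: B ∧ u = A ++ (k, d) :: (a, c) :: B := by
  induction v generalizing u with
  | nil => simp [mid]
  | cons p B ih =>
    obtain ⟨a, m⟩ := p
    simp only [mid, List.mem_append, List.mem_map, ih]
    constructor
    · rintro (h | ⟨_, ⟨A, a', B', d, c, rfl, rfl⟩, rfl⟩)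
      · cases m
        · simp at h
        · simp only [if_true, List.mem_cons, List.not_mem_nil, or_false] at h
          rcases h with rfl | rfl | rfl | rfl
          exacts [⟨[], a, B, true, true, rfl, rfl⟩, ⟨[], a, B, true, false, rfl, rfl⟩,
            ⟨[], a, B, false, true, rfl, rfl⟩, ⟨[], a, B, false, false, rfl, rfl⟩]
      · exact ⟨(a, m) :: A, a', B', d, c, rfl, rfl⟩
    · rintro ⟨A, a', B', d, c, h, rfl⟩
      rcases A with _ | ⟨p, A⟩
      · simp only [List.nil_append, List.cons.injEq, Prod.mk.injEq] at h
        obtain ⟨⟨rfl, rfl⟩, rfl⟩ := h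
        left; cases d <;> cases c <;> simp
      · simp only [List.cons_append, List.cons.injEq] at h
        obtain ⟨rfl, rfl⟩ := h
        exact Or.inr ⟨_, ⟨A, a', B', d, c, rfl, rfl⟩, rfl⟩

theorem mem_ins {k : ℕ} {v u : List (ℕ × Bool)} : u ∈ ins k v ↔
    (∃ A a B d c, v = A ++ (a, true) :: B ∧ u = A ++ (k, d) :: (a, c) :: B) ∨
      ∃ d, u = v ++ [(k, d)] := by
  rw [ins, List.mem_append, mem_mid]
  exact or_congr Iff.rfl (by simp [or_comm])

/-- The deletion of the letter `k`; the next letter gets marked. -/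
def del (k : ℕ) : List (ℕ × Bool) → List (ℕ × Bool)
  | [] => []
  | (a, m) :: B => if a = k then
      (match B with
        | [] => []
        | (b, _) :: B' => (b, true) :: B')
    else (a, m) :: del k B

theorem del_append {k : ℕ} {A B : List (ℕ × Bool)} (h : k ∉ letters A) :
    del k (A ++ B) = A ++ del k B := by
  induction A with
  | nil => rfl
  | cons p A ih =>
    simp only [letters_cons, List.mem_cons, not_or] at h
    simp [del, Ne.symm h.1, ih h.2]

theorem del_of_mem_ins {k : ℕ} {v u : List (ℕ × Bool)} (h : k ∉ letters v) (hu : u ∈ ins k v) :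
    del k u = v := by
  rcases mem_ins.1 hu with ⟨A, a, B, d, c, rfl, rfl⟩ | ⟨d, rfl⟩
  · rw [del_append (by simp at h; exact h.1)]; simp [del]
  · rw [del_append h]; simp [del]

theorem mem_ins_del {k : ℕ} {u : List (ℕ × Bool)} (h : k ∈ letters u) : u ∈ ins k (del k u) := by
  induction u with
  | nil => simp at h
  | cons p u ih =>
    obtain ⟨a, m⟩ := p
    by_cases hak : a = k
    · subst hak
      rcases u with _ | ⟨⟨b, c⟩, B⟩
      · exact mem_ins.2 (Or.inr ⟨m, by simp [del]⟩)
      · exact mem_ins.2 (Or.inl ⟨[], b, B, m, c, by simp [del], rfl⟩)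
    · have hu : k ∈ letters u := by simpa [Ne.symm hak] using h
      rcases mem_ins.1 (ih hu) with ⟨A, b, B, d, c, h1, h2⟩ | ⟨d, h2⟩
      · exact mem_ins.2 (Or.inl ⟨(a, m) :: A, b, B, d, c, by simp [del, hak, h1],
          by rw [List.cons_append, ← h2]⟩)
      · refine mem_ins.2 (Or.inr ⟨d, ?_⟩)
        simp only [del, hak, if_false, List.cons_append]
        rw [← h2]

theorem letters_perm_of_mem_ins {k : ℕ} {v u : List (ℕ × Bool)} (hu : u ∈ ins k v) :
    (letters u).Perm (k :: letters v) := by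
  rcases mem_ins.1 hu with ⟨A, a, B, d, c, rfl, rfl⟩ | ⟨d, rfl⟩
  · simp [List.perm_middle]
  · simp [List.perm_append_singleton]

theorem mem_markedWords {k : ℕ} {v : List (ℕ × Bool)} :
    v ∈ markedWords k ↔ (letters v).Perm (List.range k) := by
  induction k generalizing v with
  | zero =>
    simp only [markedWords, List.mem_singleton, List.range_zero, List.perm_nil]
    exact List.map_eq_nil_iff.symm
  | succ k ih =>
    have hp : (List.range (k + 1)).Perm (k :: List.range k) := by
      rw [List.range_succ]; exact List.perm_append_singleton _ _
    simp only [markedWords, List.mem_flatMap, ih]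
    constructor
    · rintro ⟨u, hu, hv⟩
      exact (letters_perm_of_mem_ins hv).trans ((hu.cons k).trans hp.symm)
    · intro h
      have hk : k ∈ letters v := h.mem_iff.2 (by simp)
      refine ⟨del k v, ?_, mem_ins_del hk⟩
      exact (((letters_perm_of_mem_ins (mem_ins_del hk)).symm.trans h).trans hp).cons_inv

theorem nodup_mid {k : ℕ} {v : List (ℕ × Bool)} (h : k ∉ letters v) : (mid k v).Nodup := by
  induction v with
  | nil => simp [mid]
  | cons p B ih =>
    obtain ⟨a, m⟩ := p
    simp only [letters_cons, List.mem_cons, not_or] at h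
    rw [mid, List.nodup_append]
    refine ⟨by cases m <;> simp, (ih h.2).map (List.cons_injective), ?_⟩
    intro u hu w hw he
    subst he
    obtain ⟨w', -, rfl⟩ := List.mem_map.1 hw
    cases m
    · simp at hu
    · simp [Ne.symm h.1] at hu

theorem nodup_ins {k : ℕ} {v : List (ℕ × Bool)} (h : k ∉ letters v) : (ins k v).Nodup := by
  rw [ins, List.nodup_append]
  refine ⟨nodup_mid h, by simp, ?_⟩
  intro u hu w hw he
  subst he
  obtain ⟨A, a, B, d, c, rfl, rfl⟩ := mem_mid.1 hu
  -- The new letter is the last one in `w`, but not in `u`.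
  have ha : a ≠ k := by rintro rfl; simp at h
  have hB : k ∉ letters B := by simp at h; exact h.2.2
  have hk : (letters (A ++ (k, d) :: (a, c) :: B)).getLast? = some k := by
    simp only [List.mem_cons, List.not_mem_nil, or_false] at hw
    rcases hw with hw | hw <;> rw [hw, letters_append] <;> exact List.getLast?_concat ..
  have h2 : k ∈ letters ((a, c) :: B) := by
    have : (letters (A ++ (k, d) :: (a, c) :: B)).getLast? = (letters ((a, c) :: B)).getLast? := by
      simp [List.getLast?_append, List.getLast?_cons]
    rw [this] at hk
    exact List.mem_of_getLast? hk
  simp [Ne.symm ha, hB] at h2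

theorem notMem_letters {k : ℕ} {v : List (ℕ × Bool)} (h : v ∈ markedWords k) : k ∉ letters v := by
  rw [mem_markedWords] at h
  simp [h.mem_iff]

theorem nodup_markedWords (k : ℕ) : (markedWords k).Nodup := by
  induction k with
  | zero => simp [markedWords]
  | succ k ih =>
    rw [markedWords, List.nodup_flatMap]
    refine ⟨fun v hv => nodup_ins (notMem_letters hv), ?_⟩
    refine ih.imp_of_mem ?_
    intro a b ha hb hab u hua hub
    exact hab ((del_of_mem_ins (notMem_letters ha) hua).symm.trans
      (del_of_mem_ins (notMem_letters hb) hub))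

/-- The total contribution to `mak` of the descents whose bottom lies in the marked word, where `P`
is the reversed word of the letters in front. A mark stands for a letter larger than all others,
directly in front of the marked letter; such letters are not counted themselves. A descent with top
`b` and bottom `a` contributes one more than the number of the letters `≤ b` before plus the
number of letters `< a` behind it. -/
def markedMak : List ℕ → List (ℕ × Bool) → ℕ
  | _, [] => 0
  | P, (a, true) :: B => 1 + P.length + (letters B).countP (· < a) + markedMak (a :: P) B
  | [], (a, false) :: B => markedMak [a] B
  | b :: P, (a, false) :: B =>
    (if a < b then 1 + (b :: P).countP (· < b) + (letters B).countP (· < a) else 0)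
      + markedMak (a :: b :: P) B

/-- A new largest letter in the past increases `markedMak` by the number of marks. -/
theorem markedMak_insert_prefix {k : ℕ} (B : List (ℕ × Bool)) (a : ℕ) (P P' : List ℕ)
    (hP : P'.Perm (k :: P)) (ha : a < k) (hB : ∀ b ∈ letters B, b < k) :
    markedMak (a :: P') B = markedMak (a :: P) B + marks B := by
  induction B generalizing a P P' with
  | nil => simp [markedMak]
  | cons p B ih =>
    obtain ⟨b, m⟩ := p
    simp only [letters_cons, List.mem_cons, forall_eq_or_imp] at hB
    have := ih b (a :: P) (a :: P') ((hP.cons a).trans (List.Perm.swap _ _ _)) hB.1 hB.2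
    have hl := hP.length_eq
    have hc : P'.countP (· < a) = P.countP (· < a) := by
      rw [hP.countP_eq, List.countP_cons_of_neg]; simpa using ha.le
    cases m
    · simp only [markedMak, marks_cons, this, List.countP_cons, hc, Bool.toNat_false]; ring
    · simp only [markedMak, marks_cons, this, List.length_cons, hl, Bool.toNat_true]; ring

theorem markedMak_mid {k : ℕ} (P : List ℕ) (A : List (ℕ × Bool)) (a : ℕ) (B : List (ℕ × Bool))
    (d c : Bool) (hP : ∀ b ∈ P, b < k) (h : ∀ b ∈ letters (A ++ (a, true) :: B), b < k) :
    markedMak P (A ++ (k, d) :: (a, c) :: B) = markedMak P (A ++ (a, true) :: B)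
      + (marks B + c.toNat + d.toNat * (P.length + (A ++ (a, true) :: B).length + 1)) := by
  induction A generalizing P with
  | nil =>
    simp only [List.nil_append, letters_cons, List.mem_cons, forall_eq_or_imp] at h
    have hB := markedMak_insert_prefix B a P (k :: P) (List.Perm.refl _) h.1 h.2
    have hcP : P.countP (· < k) = P.length := by
      rw [List.countP_eq_length]; simpa using hP
    have hcB : (letters B).countP (· < k) = B.length := by
      rw [List.countP_eq_length.2 (by simpa using h.2)]; simp [letters]
    have hd : ∀ B', markedMak P ((k, d) :: B') =
        d.toNat * (1 + P.length + (letters B').countP (· < k)) + markedMak (k :: P) B' := by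
      intro B'
      cases d
      · cases P with
        | nil => simp [markedMak]
        | cons b P =>
          have : ¬ k < b := by have := hP b (by simp); omega
          simp [markedMak, this]
      · simp [markedMak]
    rw [List.nil_append, List.nil_append, hd]
    cases c
    · simp [markedMak, hB, h.1, hcP, hcB]; ring
    · simp [markedMak, hB, h.1, hcB]; ring
  | cons p A ih =>
    obtain ⟨e, m⟩ := p
    simp only [List.cons_append, letters_cons, List.mem_cons, forall_eq_or_imp] at h
    have hc : (letters (A ++ (k, d) :: (a, c) :: B)).countP (· < e)
        = (letters (A ++ (a, true) :: B)).countP (· < e) := by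
      simp [h.1.le]
    have := ih (e :: P) (by simpa using ⟨h.1, hP⟩) h.2
    rcases m with _ | _
    · rcases P with _ | ⟨b, P⟩
      · simp only [List.cons_append, markedMak, this, List.length_cons]; ring
      · simp only [List.cons_append, markedMak, this, hc, List.length_cons]; ring
    · simp only [List.cons_append, markedMak, this, hc, List.length_cons]; ring

theorem markedMak_final {k : ℕ} (P : List ℕ) (A : List (ℕ × Bool)) (d : Bool)
    (hP : ∀ b ∈ P, b < k) (h : ∀ b ∈ letters A, b < k) :
    markedMak P (A ++ [(k, d)]) = markedMak P A + d.toNat * (P.length + A.length + 1) := by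
  induction A generalizing P with
  | nil =>
    cases d
    · cases P with
      | nil => simp [markedMak]
      | cons b P =>
        have : ¬ k < b := by have := hP b (by simp); omega
        simp [markedMak, this]
    · simp [markedMak]; ring
  | cons p A ih =>
    obtain ⟨e, m⟩ := p
    simp only [letters_cons, List.mem_cons, forall_eq_or_imp] at h
    have hc : (letters (A ++ [(k, d)])).countP (· < e) = (letters A).countP (· < e) := by
      simp [h.1.le]
    have := ih (e :: P) (by simpa using ⟨h.1, hP⟩) h.2
    rcases m with _ | _
    · rcases P with _ | ⟨b, P⟩
      · simp only [List.cons_append, markedMak, this, List.length_cons]; ring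
      · simp only [List.cons_append, markedMak, this, hc, List.length_cons]; ring
    · simp only [List.cons_append, markedMak, this, hc, List.length_cons]; ring

/-- The number of inversions of a word, as a list. -/
def listInv : List ℕ → ℕ
  | [] => 0
  | a :: l => l.countP (· < a) + listInv l

theorem listInv_insert {k : ℕ} (A B : List ℕ) (hA : ∀ b ∈ A, b < k) (hB : ∀ b ∈ B, b < k) :
    listInv (A ++ k :: B) = listInv (A ++ B) + B.length := by
  induction A with
  | nil =>
    simp [listInv, List.countP_eq_length.2 (show ∀ b ∈ B, decide (b < k) = true by simpa using hB)]
    ring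
  | cons a A ih =>
    simp only [List.mem_cons, forall_eq_or_imp] at hA
    simp only [List.cons_append, listInv, ih hA.2]
    simp [hA.1.le]; ring

end MarkedWords

/-! ### Insertion of the largest letter into admissible marked words -/

section Insertion

/-- The conditions, on the one-line word `l` of `π⁻¹`, for `π` to come from a set partition: with
`T` the set of the last positions of the blocks, each block of `π` is increasing, and the last
letter of each block of `π` is larger than all letters before it. -/
def Adm (T : Set ℕ) (k : ℕ) (l : List ℕ) : Prop :=
  (∀ i, i + 1 < k → i ∉ T → [i, i + 1].Sublist l) ∧
    ∀ e < k, e ∈ T → ∀ i < e, [i, e].Sublist l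

/-- The number of left-to-right maxima of `π`, in terms of the one-line word `l` of `π⁻¹`. -/
def listLrmax (k : ℕ) (l : List ℕ) : ℕ :=
  ((Finset.range k).filter fun j => ∀ i < j, [i, j].Sublist l).card

theorem pair_sublist_filter {l : List ℕ} {p : ℕ → Bool} {i j : ℕ} (hi : p i) (hj : p j) :
    [i, j].Sublist (l.filter p) ↔ [i, j].Sublist l := by
  refine ⟨fun h => h.trans List.filter_sublist, fun h => ?_⟩
  simpa [hi, hj] using h.filter p

theorem pair_sublist_insert {k i j : ℕ} {X Y : List ℕ} (hi : i ≠ k) (hj : j ≠ k) :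
    [i, j].Sublist (X ++ k :: Y) ↔ [i, j].Sublist (X ++ Y) := by
  have hi' : decide (i ≠ k) = true := by simpa using hi
  have hj' : decide (j ≠ k) = true := by simpa using hj
  rw [← pair_sublist_filter (p := fun a => decide (a ≠ k)) hi' hj',
    ← pair_sublist_filter (l := X ++ Y) (p := fun a => decide (a ≠ k)) hi' hj']
  simp

theorem pair_sublist_new {k i : ℕ} {X Y : List ℕ} (hX : k ∉ X) (hY : k ∉ Y) (hi : i ≠ k) :
    [i, k].Sublist (X ++ k :: Y) ↔ i ∈ X := by
  constructor
  · intro h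
    induction X with
    | nil =>
      rw [List.nil_append] at h
      rcases List.sublist_cons_iff.1 h with h | ⟨r, h, h'⟩
      · exact absurd (h.subset (by simp)) hY
      · simp at h; exact absurd h.1 hi
    | cons b X ih =>
      simp only [List.mem_cons, not_or] at hX
      rcases List.sublist_cons_iff.1 h with h | ⟨r, h, h'⟩
      · exact List.mem_cons_of_mem _ (ih hX.2 h)
      · simp at h; simp [h.1]
  · intro h
    exact (List.singleton_sublist.2 h).append (List.singleton_sublist.2 (by simp : k ∈ k :: Y))

theorem adm_insert {T : Set ℕ} {k : ℕ} {X Y : List ℕ} (h : (X ++ Y).Perm (List.range k)) :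
    Adm T (k + 1) (X ++ k :: Y) ↔ Adm T k (X ++ Y) ∧ (k = 0 ∨ k - 1 ∈ T ∨ k - 1 ∈ X) ∧
      (k ∈ T → ∀ i < k, i ∈ X) := by
  have hk : k ∉ X ++ Y := by simp [h.mem_iff]
  simp only [List.mem_append, not_or] at hk
  have old : ∀ {i j}, i < k → j < k →
      ([i, j].Sublist (X ++ k :: Y) ↔ [i, j].Sublist (X ++ Y)) := fun hi hj =>
    pair_sublist_insert hi.ne hj.ne
  have new : ∀ {i}, i < k → ([i, k].Sublist (X ++ k :: Y) ↔ i ∈ X) := fun hi =>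
    pair_sublist_new hk.1 hk.2 hi.ne
  constructor
  · rintro ⟨h1, h2⟩
    refine ⟨⟨fun i hi hT => (old (by omega) hi).1 (h1 i (by omega) hT),
      fun e he hT i hi => (old (by omega) he).1 (h2 e (by omega) hT i hi)⟩, ?_,
      fun hT i hi => (new hi).1 (h2 k (by omega) hT i hi)⟩
    rcases Nat.eq_zero_or_pos k with h0 | h0
    · exact Or.inl h0
    by_cases hT : k - 1 ∈ T
    · exact Or.inr (Or.inl hT)
    · have := h1 (k - 1) (by omega) hT
      rw [show k - 1 + 1 = k by omega] at this
      exact Or.inr (Or.inr ((new (by omega)).1 this))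
  · rintro ⟨⟨h1, h2⟩, h3, h4⟩
    refine ⟨fun i hi hT => ?_, fun e he hT i hi => ?_⟩
    · rcases Nat.lt_succ_iff_lt_or_eq.1 hi with hi | hi
      · exact (old (by omega) hi).2 (h1 i hi hT)
      · subst hi
        simp only [Nat.add_one_ne_zero, Nat.add_sub_cancel, hT, false_or] at h3
        exact (new (by omega)).2 h3
    · rcases Nat.lt_succ_iff_lt_or_eq.1 he with he | rfl
      · exact (old (by omega) he).2 (h2 e he hT i hi)
      · exact (new hi).2 (h4 hT i hi)

theorem listLrmax_insert {k : ℕ} {X Y : List ℕ} (h : (X ++ Y).Perm (List.range k)) :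
    listLrmax (k + 1) (X ++ k :: Y) = listLrmax k (X ++ Y) + if Y = [] then 1 else 0 := by
  have hk : k ∉ X ++ Y := by simp [h.mem_iff]
  simp only [List.mem_append, not_or] at hk
  rw [listLrmax, Finset.range_add_one, Finset.filter_insert, listLrmax]
  have hold : (Finset.range k).filter (fun j => ∀ i < j, [i, j].Sublist (X ++ k :: Y))
      = (Finset.range k).filter (fun j => ∀ i < j, [i, j].Sublist (X ++ Y)) := by
    refine Finset.filter_congr fun j hj => forall₂_congr fun i hi => ?_
    have := Finset.mem_range.1 hj
    exact pair_sublist_insert (by omega) (by omega)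
  have hnew : (∀ i < k, [i, k].Sublist (X ++ k :: Y)) ↔ Y = [] := by
    have : (∀ i < k, [i, k].Sublist (X ++ k :: Y)) ↔ ∀ i < k, i ∈ X :=
      forall₂_congr fun i hi => pair_sublist_new hk.1 hk.2 (Nat.ne_of_lt hi)
    rw [this]
    constructor
    · intro hX
      refine List.eq_nil_iff_forall_not_mem.2 fun b hb => ?_
      have hb' : b < k := by
        have := (h.mem_iff (a := b)).1 (by simp [hb]); simpa using this
      have hn : (X ++ Y).Nodup := h.nodup_iff.2 List.nodup_range
      exact (List.nodup_append.1 hn).2.2 b (hX b hb') b hb rfl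
    · rintro rfl i hi
      have := (h.mem_iff (a := i)).2 (by simpa using hi)
      simpa using this
  rw [hold]
  by_cases hY : Y = []
  · rw [if_pos (hnew.2 hY), if_pos hY, Finset.card_insert_of_notMem (by simp)]
  · rw [if_neg (fun h => hY (hnew.1 h)), if_neg hY, add_zero]

/-- The number of marks up to the letter `t` and the number of marks behind it. -/
def splitMarks (t : ℕ) : List (ℕ × Bool) → ℕ × ℕ
  | [] => (0, 0)
  | (a, m) :: B => if a = t then (m.toNat, marks B)
    else ((splitMarks t B).1 + m.toNat, (splitMarks t B).2)

theorem splitMarks_append {t : ℕ} (m : Bool) {A B : List (ℕ × Bool)} (h : t ∉ letters A) :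
    splitMarks t (A ++ (t, m) :: B) = (marks A + m.toNat, marks B) := by
  induction A with
  | nil => simp [splitMarks]
  | cons p A ih =>
    obtain ⟨a, m'⟩ := p
    simp only [letters_cons, List.mem_cons, not_or] at h
    simp only [List.cons_append, splitMarks, Ne.symm h.1, if_false, ih h.2, marks_cons]
    congr 1; ring

open Classical in
/-- The number of marks that are out of reach of the letter `k`, which is inserted next, and the
number of marks in front of which it can be inserted. -/
noncomputable def markState (T : Set ℕ) (k : ℕ) (v : List (ℕ × Bool)) : ℕ × ℕ :=
  if k = 0 ∨ k - 1 ∈ T then (0, marks v) else splitMarks (k - 1) v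

variable {R : Type*} [CommRing R]

open Classical in
/-- The sum of `W v * f g p` over the admissible marked words on `k` letters, where `(g, p)` is the
state of `v`. -/
noncomputable def markedSum (T : Set ℕ) (W : List (ℕ × Bool) → R) (k : ℕ) (f : ℕ → ℕ → R) : R :=
  ((markedWords k).map fun v => if Adm T k (letters v) then
    W v * f (markState T k v).1 (markState T k v).2 else 0).sum

theorem sum_mid_eq_slots {k : ℕ} (ω : Bool → ℕ → Bool → R) (f : ℕ → ℕ → R) (y : R)
    (V : List (ℕ × Bool)) (g : ℕ) (H : List (ℕ × Bool) → R)
    (h : ∀ A a B d c, V = A ++ (a, true) :: B → H (A ++ (k, d) :: (a, c) :: B)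
      = y * (ω d (marks B) c * f (g + marks A + d.toNat) (marks B + c.toNat))) :
    ((mid k V).map H).sum = y * slots ω f g (marks V) := by
  induction V generalizing g H with
  | nil => simp [mid, slots]
  | cons p V ih =>
    obtain ⟨a, m⟩ := p
    have ih' := ih (g + m.toNat) (fun u => H ((a, m) :: u)) (by
      rintro A b B d c rfl
      have := h ((a, m) :: A) b B d c rfl
      rw [List.cons_append] at this
      rw [this, marks_cons]
      congr 3; ring)
    rw [mid, List.map_append, List.sum_append, List.map_map]
    change _ + ((mid k V).map fun u => H ((a, m) :: u)).sum = _
    rw [ih']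
    cases m
    · simp
    · have h0 := fun d c => h [] a V d c rfl
      simp only [List.nil_append, marks_nil, add_zero] at h0
      simp [h0, slots]
      ring

theorem mid_append (k : ℕ) (X V : List (ℕ × Bool)) :
    mid k (X ++ V) = (mid k X).map (· ++ V) ++ (mid k V).map (X ++ ·) := by
  induction X with
  | nil => simp [mid]
  | cons p X ih =>
    obtain ⟨a, m⟩ := p
    rw [List.cons_append, mid, ih, mid]
    cases m <;> simp [Function.comp_def]

theorem sum_map_flatMap {ι κ : Type*} (l : List ι) (g : ι → List κ) (h : κ → R) :
    ((l.flatMap g).map h).sum = (l.map fun v => ((g v).map h).sum).sum := by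
  induction l with
  | nil => rfl
  | cons a l ih => simp [ih]

theorem markedSum_succ (T : Set ℕ) (W : List (ℕ × Bool) → R) (k : ℕ)
    (ω : Bool → ℕ → Bool → R) (ε : Bool → R) (f : ℕ → ℕ → R)
    (hmid : ∀ A a B d c, A ++ (a, true) :: B ∈ markedWords k →
      W (A ++ (k, d) :: (a, c) :: B) = W (A ++ (a, true) :: B) * ω d (marks B) c)
    (hfin : ∀ v d, v ∈ markedWords k → W (v ++ [(k, d)]) = W v * ε d) :
    markedSum T W (k + 1) f = markedSum T W k (step T ω ε k f) := by
  classical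
  rw [markedSum, markedWords, sum_map_flatMap, markedSum]
  congr 1
  refine List.map_congr_left fun v hv => ?_
  set H : List (ℕ × Bool) → R := fun v => if Adm T (k + 1) (letters v) then
    W v * f (markState T (k + 1) v).1 (markState T (k + 1) v).2 else 0 with hH
  have hperm := mem_markedWords.1 hv
  have hk := notMem_letters hv
  have hnd : (letters v).Nodup := hperm.nodup_iff.2 List.nodup_range
  have hA1 : ∀ d, Adm T (k + 1) (letters (v ++ [(k, d)])) ↔ Adm T k (letters v) := by
    intro d
    have hmem : ∀ i < k, i ∈ letters v := fun i hi => hperm.mem_iff.2 (by simpa using hi)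
    have := adm_insert (T := T) (X := letters v) (Y := []) (k := k) (by simpa using hperm)
    rw [letters_append]
    change Adm T (k + 1) (letters v ++ [k]) ↔ _
    rw [this, List.append_nil]
    refine and_iff_left ⟨?_, fun _ => hmem⟩
    rcases Nat.eq_zero_or_pos k with h0 | h0
    · exact Or.inl h0
    · exact Or.inr (Or.inr (hmem _ (by omega)))
  have hA2 : ∀ A a B d c, v = A ++ (a, true) :: B →
      (Adm T (k + 1) (letters (A ++ (k, d) :: (a, c) :: B)) ↔
        Adm T k (letters v) ∧ k ∉ T ∧ (k = 0 ∨ k - 1 ∈ T ∨ k - 1 ∈ letters A)) := by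
    rintro A a B d c rfl
    have := adm_insert (T := T) (X := letters A) (Y := a :: letters B) (k := k)
      (by simpa using hperm)
    simp only [letters_append, letters_cons]
    rw [this]
    refine and_congr_right fun _ => Iff.trans (and_congr_right fun _ => ?_) and_comm
    refine ⟨fun h hT => ?_, fun h hT => absurd hT h⟩
    have ha : a < k := by
      have := (hperm.mem_iff (a := a)).1 (by simp); simpa using this
    simp only [letters_append, letters_cons] at hnd
    exact (List.nodup_append.1 hnd).2.2 a (h hT a ha) a (by simp) rfl
  have hH1 : ∀ d, H (v ++ [(k, d)]) = if Adm T k (letters v) then W v * ε d *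
      f (markState T (k + 1) (v ++ [(k, d)])).1 (markState T (k + 1) (v ++ [(k, d)])).2 else 0 := by
    intro d
    simp only [hH, hA1, hfin _ _ hv]
  rw [ins, List.map_append, List.sum_append]
  by_cases hAdm : Adm T k (letters v)
  swap
  · rw [if_neg hAdm, List.sum_eq_zero]
    · simp [hH1, hAdm]
    · simp only [List.mem_map]
      rintro _ ⟨u, hu, rfl⟩
      obtain ⟨A, a, B, d, c, rfl, rfl⟩ := mem_mid.1 hu
      simp only [hH]
      rw [if_neg]
      rw [hA2 A a B d c rfl]
      exact fun h => hAdm h.1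
  rw [if_pos hAdm]
  have hj : (markState T k v).1 + (markState T k v).2 = marks v := by
    rw [markState]
    split_ifs with h
    · simp
    · push Not at h
      have : k - 1 ∈ letters v := hperm.mem_iff.2 (by simp; omega)
      obtain ⟨⟨b, m⟩, hb, rfl : b = k - 1⟩ := List.mem_map.1 this
      obtain ⟨A, V, rfl⟩ := List.append_of_mem hb
      rw [splitMarks_append]
      · simp; ring
      · simp only [letters_append, letters_cons] at hnd
        exact fun h => (List.nodup_append.1 hnd).2.2 _ h _ (by simp) rfl
  by_cases hT : k ∈ T
  · rw [step, if_pos hT, hj, List.sum_eq_zero]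
    · have hst : ∀ u, markState T (k + 1) u = (0, marks u) := fun u => by simp [markState, hT]
      simp [hH1, hAdm, hst, final]; ring
    · simp only [List.mem_map]
      rintro _ ⟨u, hu, rfl⟩
      obtain ⟨A, a, B, d, c, rfl, rfl⟩ := mem_mid.1 hu
      simp only [hH]
      rw [if_neg]
      rw [hA2 A a B d c rfl]
      exact fun h => h.2.1 hT
  rw [step, if_neg hT, hj]
  have hst : ∀ u, markState T (k + 1) u = splitMarks k u := fun u => by simp [markState, hT]
  have hends : ((([v ++ [(k, true)], v ++ [(k, false)]] : List _).map H).sum : R)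
      = W v * final ε f (marks v) := by
    simp [hH1, hAdm, hst, final, splitMarks_append _ hk]; ring
  rw [hends, mul_add]
  congr 1
  have hval : ∀ A a B d c, v = A ++ (a, true) :: B →
      (k = 0 ∨ k - 1 ∈ T ∨ k - 1 ∈ letters A) → H (A ++ (k, d) :: (a, c) :: B)
        = W v * (ω d (marks B) c * f (marks A + d.toNat) (marks B + c.toNat)) := by
    intro A a B d c hvA hcond
    have hkA : k ∉ letters A := by rw [hvA] at hk; simp at hk; exact hk.1
    simp only [hH]
    rw [if_pos ((hA2 A a B d c hvA).2 ⟨hAdm, hT, hcond⟩), hst, splitMarks_append _ hkA,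
      hmid A a B d c (hvA ▸ hv), ← hvA]
    simp [mul_assoc]
  by_cases hb : k = 0 ∨ k - 1 ∈ T
  · have : markState T k v = (0, marks v) := by simp [markState, hb]
    rw [this]
    refine sum_mid_eq_slots ω f (W v) v 0 H fun A a B d c hvA => ?_
    rw [hval A a B d c hvA (by tauto), zero_add]
  · have hms : markState T k v = splitMarks (k - 1) v := by simp [markState, hb]
    push Not at hb
    have : k - 1 ∈ letters v := hperm.mem_iff.2 (by simp; omega)
    obtain ⟨⟨b, m⟩, hbv, rfl : b = k - 1⟩ := List.mem_map.1 this
    obtain ⟨A₀, V, hv'⟩ := List.append_of_mem hbv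
    have hA₀ : k - 1 ∉ letters A₀ := by
      rw [hv'] at hnd
      simp only [letters_append, letters_cons] at hnd
      exact fun h => (List.nodup_append.1 hnd).2.2 _ h _ (by simp) rfl
    rw [hms, hv', splitMarks_append _ hA₀]
    have hX : A₀ ++ (k - 1, m) :: V = (A₀ ++ [(k - 1, m)]) ++ V := by simp
    rw [hX, mid_append, List.map_append, List.sum_append, List.map_map, List.map_map,
      List.sum_eq_zero, zero_add]
    · refine sum_mid_eq_slots ω f _ V _ _ fun A a B d c hVA => ?_
      have := hval ((A₀ ++ [(k - 1, m)]) ++ A) a B d c (by rw [hv', hVA]; simp) (by simp)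
      rw [← hX, ← hv']
      simp only [Function.comp_apply]
      rw [← List.append_assoc, this]
      simp [add_assoc, add_left_comm]
    · simp only [List.mem_map]
      rintro _ ⟨u, hu, rfl⟩
      obtain ⟨A, a, B, d, c, hA, rfl⟩ := mem_mid.1 hu
      simp only [hH, Function.comp_apply, List.append_assoc, List.cons_append]
      rw [if_neg]
      rw [hA2 A a (B ++ V) d c (by rw [hv', hX, hA]; simp)]
      rintro ⟨-, -, h⟩
      have hlast : k - 1 ∈ letters ((a, true) :: B) := by
        have h1 : (letters (A₀ ++ [(k - 1, m)])).getLast? = some (k - 1) := by simp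
        rw [hA] at h1
        have : (letters (A ++ (a, true) :: B)).getLast? = (letters ((a, true) :: B)).getLast? := by
          simp [List.getLast?_append, List.getLast?_cons]
        rw [this] at h1
        exact List.mem_of_getLast? h1
      have hkA : k - 1 ∈ letters A := by tauto
      have hnd' : (letters (A₀ ++ [(k - 1, m)])).Nodup := by
        rw [hv', hX, letters_append] at hnd
        exact hnd.of_append_left
      rw [hA, letters_append] at hnd'
      exact (List.nodup_append.1 hnd').2.2 _ hkA _ hlast rfl

theorem markedSum_eq_run (T : Set ℕ) (W : List (ℕ × Bool) → R)
    (ω : ℕ → Bool → ℕ → Bool → R) (ε : ℕ → Bool → R) (h0 : W [] = 1)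
    (hmid : ∀ k A a B d c, A ++ (a, true) :: B ∈ markedWords k →
      W (A ++ (k, d) :: (a, c) :: B) = W (A ++ (a, true) :: B) * ω k d (marks B) c)
    (hfin : ∀ k v d, v ∈ markedWords k → W (v ++ [(k, d)]) = W v * ε k d)
    (k : ℕ) (f : ℕ → ℕ → R) : markedSum T W k f = run T ω ε k f := by
  induction k generalizing f with
  | zero => simp [markedSum, markedWords, run, h0, markState, Adm]
  | succ k ih => rw [markedSum_succ T W k (ω k) (ε k) f (hmid k) (hfin k), ih, run]

end Insertion

/-! ### Equidistribution of `mak` and `inv` -/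

section MakInv

variable {R : Type*} [CommRing R]

/-- The words that are rearrangements of `0, …, n - 1`. -/
def permLists (n : ℕ) : Finset (List ℕ) := (List.range n).permutations.toFinset

theorem mem_permLists {n : ℕ} {l : List ℕ} : l ∈ permLists n ↔ l.Perm (List.range n) := by
  simp [permLists]

/-- `mak` of a word, as a list. -/
def listMak (l : List ℕ) : ℕ := markedMak [] (l.map fun a => (a, false))

theorem listLrmax_nil : listLrmax 0 [] = 0 := rfl

theorem length_of_mem_markedWords {k : ℕ} {v : List (ℕ × Bool)} (h : v ∈ markedWords k) :
    v.length = k := by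
  simpa [letters] using (mem_markedWords.1 h).length_eq

theorem lt_of_mem_markedWords {k : ℕ} {v : List (ℕ × Bool)} (h : v ∈ markedWords k) :
    ∀ b ∈ letters v, b < k := fun b hb => by
  simpa using ((mem_markedWords.1 h).mem_iff (a := b)).1 hb

theorem listLrmax_mid {k : ℕ} {A : List (ℕ × Bool)} {a : ℕ} {B : List (ℕ × Bool)} (d c : Bool)
    (h : A ++ (a, true) :: B ∈ markedWords k) :
    listLrmax (A ++ (k, d) :: (a, c) :: B).length (letters (A ++ (k, d) :: (a, c) :: B))
      = listLrmax (A ++ (a, true) :: B).length (letters (A ++ (a, true) :: B)) := by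
  have := listLrmax_insert (X := letters A) (Y := a :: letters B) (k := k)
    (by simpa using mem_markedWords.1 h)
  have hl := length_of_mem_markedWords h
  have hl' : (A ++ (k, d) :: (a, c) :: B).length = k + 1 := by simp at hl ⊢; omega
  rw [hl, hl']
  simpa using this

theorem listLrmax_final {k : ℕ} {v : List (ℕ × Bool)} (d : Bool) (h : v ∈ markedWords k) :
    listLrmax (v ++ [(k, d)]).length (letters (v ++ [(k, d)]))
      = listLrmax v.length (letters v) + 1 := by
  have := listLrmax_insert (X := letters v) (Y := []) (k := k)
    (by simpa using mem_markedWords.1 h)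
  have hl := length_of_mem_markedWords h
  have hl' : (v ++ [(k, d)]).length = k + 1 := by simp [hl]
  rw [hl, hl']
  simpa using this

theorem markedSum_mak (T : Set ℕ) (q x : R) (k : ℕ) (f : ℕ → ℕ → R) :
    markedSum T (fun v => q ^ markedMak [] v * x ^ listLrmax v.length (letters v)) k f
      = run T (makSlot q) (makFinal q x) k f := by
  refine markedSum_eq_run T _ _ _ ?_ ?_ ?_ k f
  · simp [markedMak, listLrmax_nil]
  · intro k A a B d c h
    have hl := length_of_mem_markedWords h
    rw [listLrmax_mid d c h, markedMak_mid [] A a B d c (by simp) (lt_of_mem_markedWords h), hl,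
      makSlot, List.length_nil, zero_add, pow_add]
    ring
  · intro k v d h
    rw [listLrmax_final d h, markedMak_final [] v d (by simp) (lt_of_mem_markedWords h),
      length_of_mem_markedWords h, makFinal, List.length_nil, zero_add, pow_add]
    ring

theorem marks_le_length (v : List (ℕ × Bool)) : marks v ≤ v.length := List.countP_le_length

theorem markedSum_inv (T : Set ℕ) (q x : R) (k : ℕ) (f : ℕ → ℕ → R) :
    markedSum T (fun v => if marks v = v.length then
        q ^ listInv (letters v) * x ^ listLrmax v.length (letters v) else 0) k f
      = run T (invSlot q) (invFinal x) k f := by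
  refine markedSum_eq_run T _ _ _ ?_ ?_ ?_ k f
  · simp [listInv, listLrmax_nil]
  · intro k A a B d c h
    have hA := marks_le_length A
    have hB := marks_le_length B
    have hlt := lt_of_mem_markedWords h
    rw [listLrmax_mid d c h]
    simp only [letters_append, letters_cons, List.mem_append] at hlt ⊢
    rw [listInv_insert _ _ (fun b hb => hlt b (Or.inl hb)) (fun b hb => hlt b (Or.inr hb))]
    simp only [marks_append, marks_cons, List.length_append, List.length_cons, invSlot,
      Bool.toNat_true]
    by_cases hm : marks A + (marks B + 1) = A.length + (B.length + 1)
    · have hB' : (letters B).length = marks B := by simp [letters]; omega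
      rw [if_pos hm]
      rcases d with _ | _ <;> rcases c with _ | _
      · rw [if_neg (by simp; omega)]; simp
      · rw [if_neg (by simp; omega)]; simp
      · rw [if_neg (by simp; omega)]; simp
      · rw [if_pos (by simp; omega), hB', pow_add]; simp; ring
    · rw [if_neg hm, if_neg, zero_mul]
      have := Bool.toNat_le d
      have := Bool.toNat_le c
      omega
  · intro k v d h
    have hv := marks_le_length v
    have := listInv_insert (k := k) (letters v) [] (lt_of_mem_markedWords h) (by simp)
    rw [listLrmax_final d h]
    simp only [letters_append, letters_cons, letters_nil, this]
    simp only [marks_append, marks_cons, marks_nil, List.length_append, List.length_singleton,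
      invFinal, List.append_nil, List.length_nil]
    by_cases hm : marks v = v.length
    · cases d
      · simp [hm]
      · simp [hm, pow_succ]; ring
    · rw [if_neg hm, if_neg, zero_mul]
      have := Bool.toNat_le d
      omega

/-- The words all whose letters carry the same mark `b` correspond to the unmarked words. -/
theorem sum_markedWords_const (n : ℕ) (b : Bool) (p : List (ℕ × Bool) → Prop) [DecidablePred p]
    (h : List (ℕ × Bool) → R) (hp : ∀ v ∈ markedWords n, p v ↔ ∀ e ∈ v, e.2 = b) :
    ((markedWords n).map fun v => if p v then h v else 0).sum
      = ∑ l ∈ permLists n, h (l.map fun a => (a, b)) := by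
  rw [← List.sum_toFinset _ (nodup_markedWords n), ← Finset.sum_filter]
  refine Finset.sum_bij' (fun v _ => letters v) (fun l _ => l.map fun a => (a, b)) ?_ ?_ ?_ ?_ ?_
  · intro v hv
    simp only [Finset.mem_filter, List.mem_toFinset] at hv
    exact mem_permLists.2 (mem_markedWords.1 hv.1)
  · intro l hl
    have hm : (l.map fun a => (a, b)) ∈ markedWords n := by
      rw [mem_markedWords]
      simpa [letters, Function.comp_def] using mem_permLists.1 hl
    simp only [Finset.mem_filter, List.mem_toFinset]
    exact ⟨hm, (hp _ hm).2 (by simp)⟩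
  · intro v hv
    simp only [Finset.mem_filter, List.mem_toFinset] at hv
    have := (hp v hv.1).1 hv.2
    simp only [letters, List.map_map]
    conv_rhs => rw [← List.map_id v]
    exact List.map_congr_left fun e he => Prod.ext rfl (this e he).symm
  · intro l hl
    simp [letters, Function.comp_def]
  · intro v hv
    simp only [Finset.mem_filter, List.mem_toFinset] at hv
    have := (hp v hv.1).1 hv.2
    congr 1
    simp only [letters, List.map_map]
    conv_lhs => rw [← List.map_id v]
    exact List.map_congr_left fun e he => Prod.ext rfl (this e he)

open Classical in
/-- `mak` and `inv` are equidistributed over the words that come from the set partitions with given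
block sizes, jointly with the number of left-to-right maxima. -/
theorem sum_listMak_eq_sum_listInv (T : Set ℕ) (q x : R) (n : ℕ) (hn : n = 0 ∨ n - 1 ∈ T) :
    ∑ l ∈ (permLists n).filter (Adm T n), q ^ listMak l * x ^ listLrmax n l
      = ∑ l ∈ (permLists n).filter (Adm T n), q ^ listInv l * x ^ listLrmax n l := by
  obtain ⟨G, hG⟩ := exists_run_eq T q x n hn
  have hst : ∀ v, markState T n v = (0, marks v) := fun v => by simp [markState, hn]
  have hlet : ∀ (l : List ℕ) (b : Bool), letters (l.map fun a => (a, b)) = l := by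
    simp [letters, Function.comp_def]
  have hlen : ∀ l ∈ permLists n, l.length = n := fun l hl => by
    simpa using (mem_permLists.1 hl).length_eq
  -- Only the words without marks are counted.
  have h1 := (hG fun _ p => if p = 0 then 1 else 0).1
  rw [markSum_delta, ← markedSum_mak, markedSum] at h1
  have h1' := sum_markedWords_const n false (fun v => marks v = 0)
    (fun v => if Adm T n (letters v) then
      q ^ markedMak [] v * x ^ listLrmax v.length (letters v) else 0)
    (fun v _ => by simp [marks, List.countP_eq_zero])
  -- Only the words all whose letters are marked are counted.
  have h2 := (hG fun _ _ => 1).2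
  rw [← markedSum_inv, markedSum] at h2
  have h2' := sum_markedWords_const n true (fun v => marks v = v.length)
    (fun v => if Adm T n (letters v) then
      q ^ listInv (letters v) * x ^ listLrmax v.length (letters v) else 0)
    (fun v _ => by simp [marks, List.countP_eq_length])
  rw [Finset.sum_filter, Finset.sum_filter]
  trans G
  · rw [← mul_one G, ← h1]
    refine Eq.trans (Finset.sum_congr rfl fun l hl => ?_) (h1'.symm.trans ?_)
    · simp only [hlet, List.length_map, hlen l hl]; rfl
    · congr 1
      refine List.map_congr_left fun v _ => ?_
      simp only [hst]
      split_ifs <;> simp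
  · rw [← mul_one G, ← h2]
    refine Eq.symm (Eq.trans (Finset.sum_congr rfl fun l hl => ?_) (h2'.symm.trans ?_))
    · simp only [hlet, List.length_map, hlen l hl]
    · congr 1
      refine List.map_congr_left fun v _ => ?_
      split_ifs <;> simp

end MakInv

/-! ### Kadell's bijection on reversed words -/

section Kadell

/-- The number of inversions of the word whose reversal is given. -/
def revInv : List ℕ → ℕ
  | [] => 0
  | x :: u => u.countP (x < ·) + revInv u

/-- `inv_r` with `r = s + 1` of the word whose reversal is given. -/
def revInvr (s : ℕ) : List ℕ → ℕ
  | [] => 0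
  | x :: u => (u.take s).countP (x < ·)
      + (if ∃ b ∈ (u.drop s).head?, x < b then (u.drop s).length else 0) + revInvr s u

/-- In the word `a :: l`, cut in front of the letters that satisfy `P`, the first letter of each
factor is moved to the end of the factor; here `a` is supposed to satisfy `P`. -/
def rot (P : ℕ → Bool) : ℕ → List ℕ → List ℕ
  | a, [] => [a]
  | a, b :: l => if P b then a :: rot P b l else b :: rot P a l

theorem rot_perm (P : ℕ → Bool) (a : ℕ) (l : List ℕ) : (rot P a l).Perm (a :: l) := by
  induction l generalizing a with
  | nil => exact List.Perm.refl _
  | cons b l ih =>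
    rw [rot]
    split_ifs
    · exact (ih b).cons a
    · exact ((ih a).cons b).trans (List.Perm.swap _ _ _)

theorem rot_filter (P : ℕ → Bool) (a : ℕ) (l : List ℕ) (ha : P a) :
    (rot P a l).filter P = (a :: l).filter P := by
  induction l generalizing a with
  | nil => rfl
  | cons b l ih =>
    rw [rot]
    split_ifs with hb
    · simp [ha, hb, ih b hb]
    · simp [ha, hb, ih a ha]

theorem rot_filter_not (P : ℕ → Bool) (a : ℕ) (l : List ℕ) (ha : P a) :
    (rot P a l).filter (fun b => !P b) = (a :: l).filter fun b => !P b := by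
  induction l generalizing a with
  | nil => rfl
  | cons b l ih =>
    rw [rot]
    split_ifs with hb
    · simp [ha, hb, ih b hb]
    · simp [ha, hb, ih a ha]

theorem rot_injective (P : ℕ → Bool) {a a' : ℕ} {l l' : List ℕ} (ha : P a) (ha' : P a')
    (h : rot P a l = rot P a' l') : a = a' ∧ l = l' := by
  induction l generalizing a a' l' with
  | nil =>
    have := congrArg List.length h
    rw [(rot_perm P a []).length_eq, (rot_perm P a' l').length_eq] at this
    obtain rfl : l' = [] := List.length_eq_zero_iff.1 (by simpa using this.symm)
    simpa [rot] using h
  | cons b l ih =>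
    rcases l' with _ | ⟨b', l'⟩
    · have := congrArg List.length h
      rw [(rot_perm P a _).length_eq, (rot_perm P a' _).length_eq] at this
      simp at this
    · rw [rot, rot] at h
      split_ifs at h with hb hb' hb'
      · obtain ⟨h1, h2⟩ := List.cons.inj h
        obtain ⟨h3, h4⟩ := ih hb hb' h2
        exact ⟨h1, by rw [h3, h4]⟩
      · obtain ⟨h1, h2⟩ := List.cons.inj h
        exact absurd (h1 ▸ ha) hb'
      · obtain ⟨h1, h2⟩ := List.cons.inj h
        exact absurd (h1 ▸ ha') hb
      · obtain ⟨h1, h2⟩ := List.cons.inj h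
        obtain ⟨h3, h4⟩ := ih ha ha' h2
        exact ⟨h3, by rw [h1, h4]⟩

theorem exists_getLast?_rot (P : ℕ → Bool) (a : ℕ) (l : List ℕ) (ha : P a) :
    ∃ c, (rot P a l).getLast? = some c ∧ P c := by
  induction l generalizing a with
  | nil => exact ⟨a, rfl, ha⟩
  | cons b l ih =>
    rw [rot]
    split_ifs with hb
    · obtain ⟨c, hc, hP⟩ := ih b hb
      exact ⟨c, by simp [List.getLast?_cons, hc], hP⟩
    · obtain ⟨c, hc, hP⟩ := ih a ha
      exact ⟨c, by simp [List.getLast?_cons, hc], hP⟩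

theorem revInv_rot_le (x a : ℕ) (l : List ℕ) (ha : a ≤ x) :
    revInv (rot (fun b => decide (b ≤ x)) a l) + (a :: l).countP (x < ·) = revInv (a :: l) := by
  induction l generalizing a with
  | nil => simp [rot, revInv, ha]
  | cons b l ih =>
    rw [rot]
    by_cases hb : b ≤ x
    · have := ih b hb
      simp only [hb, decide_true, if_true, revInv, (rot_perm _ b l).countP_eq]
      simp only [revInv] at this
      rw [List.countP_cons_of_neg (p := fun b => decide (x < b)) (a := a) (by simpa using ha)]
      omega
    · have := ih a ha
      rw [if_neg (by simpa using hb)]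
      simp only [revInv, (rot_perm _ a l).countP_eq]
      simp only [revInv] at this
      have h1 : ¬ b < a := by omega
      have h2 : a < b := by omega
      simp [ha, h1, h2, not_le.1 hb] at this ⊢
      omega

theorem revInv_rot_lt (x a : ℕ) (l : List ℕ) (ha : x < a) :
    revInv (rot (fun b => decide (x < b)) a l) = revInv (a :: l) + (a :: l).countP (· ≤ x) := by
  induction l generalizing a with
  | nil => simp [rot, revInv, ha]
  | cons b l ih =>
    rw [rot]
    by_cases hb : x < b
    · have := ih b hb
      simp only [hb, decide_true, if_true, revInv, (rot_perm _ b l).countP_eq]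
      simp only [revInv] at this
      rw [List.countP_cons_of_neg (p := fun b => decide (b ≤ x)) (a := a) (by simpa using ha)]
      omega
    · have := ih a ha
      rw [if_neg (by simpa using hb)]
      simp only [revInv, (rot_perm _ a l).countP_eq]
      simp only [revInv] at this
      have h1 : b < a := by omega
      have h2 : ¬ a < b := by omega
      simp [ha, h1, h2, not_lt.1 hb] at this ⊢
      omega

/-- The operation `γ_x` of Foata's bijection on reversed words: the word is cut in front of the
letters that lie on the same side of `x` as its first letter, and the factors are rotated. -/
def foataRot (x : ℕ) : List ℕ → List ℕ
  | [] => []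
  | a :: l => if a ≤ x then rot (fun b => decide (b ≤ x)) a l
    else rot (fun b => decide (x < b)) a l

theorem foataRot_perm (x : ℕ) (l : List ℕ) : (foataRot x l).Perm l := by
  cases l with
  | nil => exact List.Perm.refl _
  | cons a l => rw [foataRot]; split_ifs <;> exact rot_perm _ a l

theorem foataRot_filter_le (x : ℕ) (l : List ℕ) :
    (foataRot x l).filter (fun b => decide (b ≤ x)) = l.filter fun b => decide (b ≤ x) := by
  cases l with
  | nil => rfl
  | cons a l =>
    rw [foataRot]
    split_ifs with h
    · exact rot_filter _ a l (by simpa using h)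
    · simpa [← decide_not] using rot_filter_not (fun b => decide (x < b)) a l (by simpa using h)

theorem foataRot_filter_lt (x : ℕ) (l : List ℕ) :
    (foataRot x l).filter (fun b => decide (x < b)) = l.filter fun b => decide (x < b) := by
  cases l with
  | nil => rfl
  | cons a l =>
    rw [foataRot]
    split_ifs with h
    · simpa [← decide_not] using rot_filter_not (fun b => decide (b ≤ x)) a l (by simpa using h)
    · exact rot_filter _ a l (by simpa using h)

theorem foataRot_injective (x : ℕ) : Function.Injective (foataRot x) := by
  intro l l' h
  have hl := congrArg List.length h
  rw [(foataRot_perm x l).length_eq, (foataRot_perm x l').length_eq] at hl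
  rcases l with _ | ⟨a, l⟩ <;> rcases l' with _ | ⟨a', l'⟩
  · rfl
  · simp at hl
  · simp at hl
  · rw [foataRot, foataRot] at h
    -- The last letter tells on which side of `x` the first letter was.
    split_ifs at h with ha ha' ha'
    · obtain ⟨h1, h2⟩ := rot_injective _ (by simpa using ha) (by simpa using ha') h
      rw [h1, h2]
    · obtain ⟨c, hc, hP⟩ := exists_getLast?_rot (fun b => decide (b ≤ x)) a l (by simpa using ha)
      obtain ⟨c', hc', hP'⟩ := exists_getLast?_rot (fun b => decide (x < b)) a' l'
        (by simpa using ha')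
      rw [h, hc'] at hc
      obtain rfl := Option.some.inj hc
      simp at hP hP'; omega
    · obtain ⟨c, hc, hP⟩ := exists_getLast?_rot (fun b => decide (x < b)) a l (by simpa using ha)
      obtain ⟨c', hc', hP'⟩ := exists_getLast?_rot (fun b => decide (b ≤ x)) a' l'
        (by simpa using ha')
      rw [h, hc'] at hc
      obtain rfl := Option.some.inj hc
      simp at hP hP'; omega
    · obtain ⟨h1, h2⟩ := rot_injective _ (by simpa using ha) (by simpa using ha') h
      rw [h1, h2]

theorem revInv_foataRot (x : ℕ) (l : List ℕ) :
    revInv (foataRot x l) + l.countP (x < ·)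
      = revInv l + if ∃ b ∈ l.head?, x < b then l.length else 0 := by
  cases l with
  | nil => simp [foataRot, revInv]
  | cons a l =>
    rw [foataRot]
    split_ifs with h h' h'
    · simp at h'; omega
    · rw [revInv_rot_le x a l h, add_zero]
    · rw [revInv_rot_lt x a l (by omega), add_assoc]
      congr 1
      have := List.length_eq_countP_add_countP (fun b => decide (b ≤ x)) (l := a :: l)
      rw [this]
      congr 1
      refine List.countP_congr fun b _ => by simp
    · simp at h'; omega

theorem revInv_append_perm (u : List ℕ) {p p' : List ℕ} (h : p.Perm p') :
    revInv (u ++ p) + revInv p' = revInv (u ++ p') + revInv p := by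
  induction u with
  | nil => simp [add_comm]
  | cons a u ih =>
    simp only [List.cons_append, revInv, List.countP_append, h.countP_eq]
    omega

/-- Kadell's bijection for `r = s + 1` on reversed words. For `s = 0` it is Foata's. -/
def kadell (s : ℕ) : List ℕ → List ℕ
  | [] => []
  | x :: u => x :: ((kadell s u).take s ++ foataRot x ((kadell s u).drop s))

theorem kadell_perm (s : ℕ) (w : List ℕ) : (kadell s w).Perm w := by
  induction w with
  | nil => exact List.Perm.refl _
  | cons x u ih =>
    refine List.Perm.cons x (List.Perm.trans ?_ ih)
    conv_rhs => rw [← List.take_append_drop s (kadell s u)]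
    exact (foataRot_perm x _).append_left _

theorem kadell_take (s : ℕ) (w : List ℕ) : (kadell s w).take (s + 1) = w.take (s + 1) := by
  induction w with
  | nil => rfl
  | cons x u ih =>
    rw [kadell, List.take_succ_cons, List.take_succ_cons]
    congr 1
    have h1 : (kadell s u).take s = u.take s := by
      have := congrArg (List.take s) ih
      simpa [List.take_take] using this
    rw [← h1]
    by_cases hs : s ≤ (kadell s u).length
    · rw [List.take_append_of_le_length (by simp [hs]), List.take_take, min_self]
    · rw [List.drop_eq_nil_of_le (by omega), foataRot, List.append_nil, List.take_take, min_self]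

theorem kadell_injective (s : ℕ) : Function.Injective (kadell s) := by
  intro w
  induction w with
  | nil =>
    intro w' h
    have := congrArg List.length h
    rw [(kadell_perm s _).length_eq, (kadell_perm s _).length_eq] at this
    exact (List.length_eq_zero_iff.1 this.symm).symm
  | cons x u ih =>
    intro w' h
    have hl := congrArg List.length h
    rw [(kadell_perm s _).length_eq, (kadell_perm s _).length_eq] at hl
    rcases w' with _ | ⟨x', u'⟩
    · simp at hl
    · rw [kadell, kadell] at h
      obtain ⟨rfl, h⟩ := List.cons.inj h
      have hl' : (kadell s u).length = (kadell s u').length := by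
        rw [(kadell_perm s _).length_eq, (kadell_perm s _).length_eq]; simpa using hl
      obtain ⟨h1, h2⟩ := List.append_inj h (by simp [hl'])
      have h3 := foataRot_injective x h2
      have h4 : kadell s u = kadell s u' := by
        rw [← List.take_append_drop s (kadell s u), h1, h3, List.take_append_drop]
      rw [ih h4]

theorem revInv_kadell (s : ℕ) (w : List ℕ) : revInv (kadell s w) = revInvr s w := by
  induction w with
  | nil => rfl
  | cons x u ih =>
    have hs := kadell_take s u
    have h1 : (kadell s u).take s = u.take s := by
      have := congrArg (List.take s) hs
      simpa [List.take_take] using this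
    have h2 : ((kadell s u).drop s).head? = (u.drop s).head? := by
      rw [List.head?_drop, List.head?_drop]
      have := congrArg (fun l : List ℕ => l[s]?) hs
      simpa [List.getElem?_take] using this
    have h3 : ((kadell s u).drop s).length = (u.drop s).length := by
      simp [(kadell_perm s u).length_eq]
    have h4 := revInv_foataRot x ((kadell s u).drop s)
    have h5 := revInv_append_perm ((kadell s u).take s) (foataRot_perm x ((kadell s u).drop s))
    rw [List.take_append_drop] at h5
    rw [h2, h3] at h4
    rw [kadell, revInv, revInvr, List.countP_append, (foataRot_perm x _).countP_eq, ← ih]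
    rw [h1] at h5 ⊢
    omega

theorem pair_sublist_kadellStep (s x : ℕ) (v : List ℕ) {i j : ℕ}
    (h : (i ≤ x ∧ j ≤ x) ∨ (x < i ∧ x < j)) :
    [i, j].Sublist (v.take s ++ foataRot x (v.drop s)) ↔ [i, j].Sublist v := by
  rcases h with ⟨hi, hj⟩ | ⟨hi, hj⟩
  · have hi' : decide (i ≤ x) = true := by simpa using hi
    have hj' : decide (j ≤ x) = true := by simpa using hj
    rw [← pair_sublist_filter (p := fun b => decide (b ≤ x)) hi' hj',
      ← pair_sublist_filter (l := v) (p := fun b => decide (b ≤ x)) hi' hj', List.filter_append,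
      foataRot_filter_le, ← List.filter_append, List.take_append_drop]
  · have hi' : decide (x < i) = true := by simpa using hi
    have hj' : decide (x < j) = true := by simpa using hj
    rw [← pair_sublist_filter (p := fun b => decide (x < b)) hi' hj',
      ← pair_sublist_filter (l := v) (p := fun b => decide (x < b)) hi' hj', List.filter_append,
      foataRot_filter_lt, ← List.filter_append, List.take_append_drop]

theorem pair_sublist_cons_of_ne {x i j : ℕ} {u : List ℕ} (h : i ≠ x) :
    [i, j].Sublist (x :: u) ↔ [i, j].Sublist u := by
  rw [List.sublist_cons_iff]
  refine ⟨?_, Or.inl⟩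
  rintro (h' | ⟨r, h', -⟩)
  · exact h'
  · exact absurd (List.cons.inj h').1 h

/-- Kadell's bijection preserves the relative order of two consecutive letters. -/
theorem kadell_consecutive (s : ℕ) {w : List ℕ} (hw : w.Nodup) (i : ℕ) :
    [i + 1, i].Sublist (kadell s w) ↔ [i + 1, i].Sublist w := by
  induction w with
  | nil => rfl
  | cons x u ih =>
    obtain ⟨hx, hu⟩ := List.nodup_cons.1 hw
    by_cases h1 : i + 1 = x
    · subst h1
      have := (kadell_perm s ((i + 1) :: u)).mem_iff (a := i)
      rw [kadell] at this ⊢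
      simpa using this
    · rw [kadell, pair_sublist_cons_of_ne h1, pair_sublist_cons_of_ne h1]
      by_cases h2 : i = x
      · subst h2
        refine iff_of_false (fun h => ?_) fun h => hx (h.subset (by simp))
        have := h.subset (a := i) (by simp)
        have hp := kadell_perm s (i :: u)
        rw [kadell] at hp
        exact (List.nodup_cons.1 (hp.nodup_iff.2 hw)).1 this
      · rw [pair_sublist_kadellStep s x _ (by omega), ih hu]

/-- Kadell's bijection preserves the right-to-left minima. -/
theorem kadell_minimum (s : ℕ) {w : List ℕ} (hw : w.Nodup) (j : ℕ) :
    (∀ i < j, i ∈ w → [j, i].Sublist (kadell s w)) ↔ ∀ i < j, i ∈ w → [j, i].Sublist w := by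
  induction w with
  | nil => simp
  | cons x u ih =>
    obtain ⟨hx, hu⟩ := List.nodup_cons.1 hw
    have hp := kadell_perm s (x :: u)
    have hx' := (List.nodup_cons.1 (hp.nodup_iff.2 hw)).1
    rcases lt_trichotomy x j with h | rfl | h
    · refine iff_of_false (fun h' => ?_) fun h' => ?_
      · have := h' x h (by simp)
        rw [kadell, pair_sublist_cons_of_ne h.ne'] at this
        exact hx' (this.subset (by simp))
      · have := h' x h (by simp)
        rw [pair_sublist_cons_of_ne h.ne'] at this
        exact hx (this.subset (by simp))
    · refine iff_of_true (fun i hi hm => ?_) fun i hi hm => ?_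
      · have := hp.mem_iff.2 hm
        rw [kadell] at this ⊢
        simpa [hi.ne] using this
      · simpa [hi.ne] using hm
    · refine Iff.trans (forall₂_congr fun i hi => ?_)
        ((ih hu).trans (forall₂_congr fun i hi => ?_))
      · have : i ≠ x := by omega
        rw [kadell, pair_sublist_cons_of_ne h.ne, pair_sublist_kadellStep s x _ (by omega)]
        simp [this]
      · have : i ≠ x := by omega
        rw [pair_sublist_cons_of_ne h.ne]
        simp [this]

/-- Kadell's bijection on words. -/
def kadellWord (s : ℕ) (l : List ℕ) : List ℕ := (kadell s l.reverse).reverse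

theorem pair_sublist_reverse {i j : ℕ} {l : List ℕ} :
    [i, j].Sublist l.reverse ↔ [j, i].Sublist l := by
  rw [← List.reverse_sublist]; simp

theorem kadellWord_perm (s : ℕ) (l : List ℕ) : (kadellWord s l).Perm l :=
  (List.reverse_perm _).trans ((kadell_perm s _).trans (List.reverse_perm _))

theorem kadellWord_consecutive (s : ℕ) {l : List ℕ} (hl : l.Nodup) (i : ℕ) :
    [i, i + 1].Sublist (kadellWord s l) ↔ [i, i + 1].Sublist l := by
  rw [kadellWord, pair_sublist_reverse, kadell_consecutive s (List.nodup_reverse.2 hl),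
    pair_sublist_reverse]

theorem kadellWord_minimum (s : ℕ) {n : ℕ} {l : List ℕ} (hl : l.Perm (List.range n)) {j : ℕ}
    (hj : j < n) :
    (∀ i < j, [i, j].Sublist (kadellWord s l)) ↔ ∀ i < j, [i, j].Sublist l := by
  have hmem : ∀ i < j, i ∈ l.reverse := fun i hi => by
    rw [List.mem_reverse, hl.mem_iff, List.mem_range]; omega
  have := kadell_minimum s (List.nodup_reverse.2 (hl.nodup_iff.2 List.nodup_range)) j
  simp only [kadellWord, pair_sublist_reverse] at this ⊢
  constructor
  · intro h i hi
    exact this.1 (fun i hi _ => h i hi) i hi (hmem i hi)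
  · intro h i hi
    exact this.2 (fun i hi _ => h i hi) i hi (hmem i hi)

theorem adm_kadellWord (T : Set ℕ) (s : ℕ) {n : ℕ} {l : List ℕ} (hl : l.Perm (List.range n)) :
    Adm T n (kadellWord s l) ↔ Adm T n l := by
  refine and_congr (forall₃_congr fun i _ _ =>
      kadellWord_consecutive s (hl.nodup_iff.2 List.nodup_range) i)
    (forall₃_congr fun e he _ => kadellWord_minimum s hl he)

theorem listLrmax_kadellWord (s : ℕ) {n : ℕ} {l : List ℕ} (hl : l.Perm (List.range n)) :
    listLrmax n (kadellWord s l) = listLrmax n l := by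
  rw [listLrmax, listLrmax]
  congr 1
  exact Finset.filter_congr fun j hj => kadellWord_minimum s hl (Finset.mem_range.1 hj)

open Classical in
/-- `inv` and `inv_r` are equidistributed over the words that come from the set partitions with
given block sizes, jointly with the number of left-to-right maxima. -/
theorem sum_revInv_eq_sum_revInvr {R : Type*} [CommRing R] (T : Set ℕ) (q x : R) (n s : ℕ) :
    ∑ l ∈ (permLists n).filter (Adm T n), q ^ revInv l.reverse * x ^ listLrmax n l
      = ∑ l ∈ (permLists n).filter (Adm T n), q ^ revInvr s l.reverse * x ^ listLrmax n l := by
  have hinj : Function.Injective (kadellWord s) := fun l l' h =>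
    List.reverse_injective (kadell_injective s (List.reverse_injective h))
  have himg : ((permLists n).filter (Adm T n)).image (kadellWord s)
      = (permLists n).filter (Adm T n) := by
    refine Finset.eq_of_subset_of_card_le ?_ (Finset.card_image_of_injective _ hinj).ge
    intro l hl
    obtain ⟨l, h, rfl⟩ := Finset.mem_image.1 hl
    obtain ⟨h1, h2⟩ := Finset.mem_filter.1 h
    rw [mem_permLists] at h1
    exact Finset.mem_filter.2 ⟨mem_permLists.2 ((kadellWord_perm s l).trans h1),
      (adm_kadellWord T s h1).2 h2⟩
  rw [← himg, Finset.sum_image fun l _ l' _ h => hinj h, himg]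
  refine Finset.sum_congr rfl fun l hl => ?_
  have h1 := mem_permLists.1 (Finset.mem_filter.1 hl).1
  rw [listLrmax_kadellWord s h1, kadellWord, List.reverse_reverse, revInv_kadell]

end Kadell

/-! ### Statistics of functions as statistics of lists -/

section Translation

theorem ofFn_reverse_succ {n : ℕ} (w : Fin (n + 1) → ℕ) :
    (List.ofFn w).reverse
      = w (Fin.last n) :: (List.ofFn fun i : Fin n => w i.castSucc).reverse := by
  rw [List.ofFn_succ_last, List.reverse_append]; rfl

theorem countP_take_reverse_ofFn {n : ℕ} (w : Fin n → ℕ) (p : ℕ → Bool) (s : ℕ) :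
    (((List.ofFn w).reverse).take s).countP p
      = ∑ i : Fin n, if n < (i : ℕ) + s + 1 ∧ p (w i) then 1 else 0 := by
  induction n generalizing s with
  | zero => simp
  | succ n ih =>
    rw [ofFn_reverse_succ]
    cases s with
    | zero =>
      rw [List.take_zero, List.countP_nil]
      refine (Finset.sum_eq_zero fun i _ => if_neg ?_).symm
      have := i.2; omega
    | succ s =>
      rw [List.take_succ_cons, List.countP_cons, ih, Fin.sum_univ_castSucc]
      congr 1
      · refine Finset.sum_congr rfl fun i _ => if_congr ?_ rfl rfl
        simp only [Fin.val_castSucc]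
        exact and_congr_left fun _ => by omega
      · refine if_congr ?_ rfl rfl
        simp

theorem head_drop_reverse_ofFn {n : ℕ} (w : Fin n → ℕ) (p : ℕ → Prop) [DecidablePred p] (s : ℕ) :
    (if ∃ b ∈ (((List.ofFn w).reverse).drop s).head?, p b
      then (((List.ofFn w).reverse).drop s).length else 0)
      = ∑ i : Fin n, if n = (i : ℕ) + s + 1 ∧ p (w i) then (i : ℕ) + 1 else 0 := by
  induction n generalizing s with
  | zero => simp
  | succ n ih =>
    rw [ofFn_reverse_succ, Fin.sum_univ_castSucc]
    cases s with
    | zero =>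
      rw [Finset.sum_eq_zero, zero_add]
      · simp
      · intro i _
        have := i.2
        refine if_neg ?_
        simp only [Fin.val_castSucc]; omega
    | succ s =>
      rw [List.drop_succ_cons, ih]
      rw [if_neg (by simp), add_zero]
      refine Finset.sum_congr rfl fun i _ => if_congr ?_ rfl rfl
      simp only [Fin.val_castSucc]
      exact and_congr_left fun _ => by omega

theorem invr_eq_sum {n : ℕ} (r : ℕ) (w : Fin n → ℕ) :
    invr r w = ∑ j : Fin n,
      ((∑ i : Fin n, if i < j ∧ (j : ℕ) < (i : ℕ) + r ∧ w j < w i then 1 else 0)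
      + ∑ i : Fin n, if (j : ℕ) = (i : ℕ) + r ∧ w j < w i then (i : ℕ) + 1 else 0) := by
  conv_rhs => rw [Finset.sum_add_distrib]
  rw [invr, Finset.card_filter, Fintype.sum_prod_type_right]
  congr 1
  conv_rhs => rw [Finset.sum_comm]
  rw [Finset.sum_filter]
  refine Finset.sum_congr rfl fun i _ => ?_
  split_ifs with h
  · obtain ⟨j, hj, hw⟩ := h
    rw [Finset.sum_eq_single j]
    · simp [hj, hw]
    · intro j' _ hne
      refine if_neg fun h => hne (Fin.ext (by omega))
    · simp
  · exact (Finset.sum_eq_zero fun j _ => if_neg fun hj => h ⟨j, hj⟩).symm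

theorem invr_eq_revInvr {n : ℕ} (s : ℕ) (w : Fin n → ℕ) :
    invr (s + 1) w = revInvr s (List.ofFn w).reverse := by
  rw [invr_eq_sum]
  induction n with
  | zero => simp [revInvr]
  | succ n ih =>
    rw [ofFn_reverse_succ, revInvr, Fin.sum_univ_castSucc, ← ih, add_comm (Finset.sum _ _)]
    congr 1
    · rw [countP_take_reverse_ofFn, head_drop_reverse_ofFn (p := fun b => w (Fin.last n) < b)]
      congr 1
      · rw [Fin.sum_univ_castSucc, if_neg (by simp), add_zero]
        refine Finset.sum_congr rfl fun i _ => if_congr ?_ rfl rfl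
        simp [Fin.castSucc_lt_last, add_assoc]
      · rw [Fin.sum_univ_castSucc, if_neg (by simp), add_zero]
        refine Finset.sum_congr rfl fun i _ => if_congr ?_ rfl rfl
        simp [add_assoc]
    · refine Finset.sum_congr rfl fun j _ => ?_
      rw [Fin.sum_univ_castSucc, Fin.sum_univ_castSucc, if_neg, if_neg, add_zero, add_zero]
      · simp
      · simp only [Fin.val_castSucc, Fin.val_last]; have := j.2; omega
      · rintro ⟨h, -⟩
        exact absurd (Fin.le_last _) (not_le.2 h)

theorem revInv_concat (u : List ℕ) (a : ℕ) :
    revInv (u ++ [a]) = revInv u + u.countP (· < a) := by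
  induction u with
  | nil => simp [revInv]
  | cons b u ih =>
    simp only [List.cons_append, revInv, ih, List.countP_append, List.countP_cons, List.countP_nil]
    simp only [decide_eq_true_eq]
    omega

theorem listInv_eq_revInv (l : List ℕ) : listInv l = revInv l.reverse := by
  induction l with
  | nil => rfl
  | cons a l ih => rw [List.reverse_cons, revInv_concat, listInv, ih, List.countP_reverse, add_comm]

theorem revInvr_eq_revInv {s : ℕ} (l : List ℕ) (h : l.length ≤ s) : revInvr s l = revInv l := by
  induction l with
  | nil => rfl
  | cons x u ih =>
    simp only [List.length_cons] at h
    rw [revInvr, revInv, List.take_of_length_le (by omega), List.drop_of_length_le (by omega),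
      ih (by omega)]
    simp

theorem inv_eq_listInv {n : ℕ} (w : Fin n → ℕ) : inv w = listInv (List.ofFn w) := by
  rw [listInv_eq_revInv, ← revInvr_eq_revInv (s := n) _ (by simp), ← invr_eq_revInvr, invr, inv]
  rw [Finset.sum_eq_zero, add_zero]
  · congr 1
    refine Finset.filter_congr fun p _ => and_congr_right fun _ => ?_
    have := p.2.2
    exact (and_iff_right (by omega)).symm
  · intro i hi
    obtain ⟨j, hj, -⟩ := (Finset.mem_filter.1 hi).2
    have := j.2; omega

theorem countP_take_ofFn {n : ℕ} (w : Fin n → ℕ) (p : ℕ → Bool) (k : ℕ) :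
    ((List.ofFn w).take k).countP p = ∑ i : Fin n, if (i : ℕ) < k ∧ p (w i) then 1 else 0 := by
  induction n generalizing k with
  | zero => simp
  | succ n ih =>
    rw [List.ofFn_succ]
    cases k with
    | zero => simp
    | succ k =>
      rw [List.take_succ_cons, List.countP_cons, ih, Fin.sum_univ_succ, add_comm]
      simp

theorem countP_drop_ofFn {n : ℕ} (w : Fin n → ℕ) (p : ℕ → Bool) (k : ℕ) :
    ((List.ofFn w).drop k).countP p = ∑ i : Fin n, if k ≤ (i : ℕ) ∧ p (w i) then 1 else 0 := by
  induction n generalizing k with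
  | zero => simp
  | succ n ih =>
    rw [List.ofFn_succ]
    cases k with
    | zero =>
      have := ih (fun i => w i.succ) 0
      rw [List.drop_zero] at this
      rw [List.drop_zero, List.countP_cons, this, Fin.sum_univ_succ, add_comm]
      simp
    | succ k =>
      rw [List.drop_succ_cons, ih, Fin.sum_univ_succ]
      simp

/-- The contribution to `mak` of a letter `a` that follows the word with reversal `P` and is
followed by `B`. -/
def makTerm : List ℕ → ℕ → List ℕ → ℕ
  | [], _, _ => 0
  | b :: P, a, B => if a < b then 1 + (b :: P).countP (· < b) + B.countP (· < a) else 0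

theorem markedMak_eq_sum {n : ℕ} (w : Fin n → ℕ) (P : List ℕ) :
    markedMak P ((List.ofFn w).map fun a => (a, false))
      = ∑ j : Fin n, makTerm (((List.ofFn w).take j).reverse ++ P) (w j)
          ((List.ofFn w).drop (j + 1)) := by
  induction n generalizing P with
  | zero => simp [markedMak]
  | succ n ih =>
    rw [List.ofFn_succ, List.map_cons, Fin.sum_univ_succ]
    have := ih (fun i => w i.succ) (w 0 :: P)
    have hl : letters ((List.ofFn fun i : Fin n => w i.succ).map fun a => (a, false))
        = List.ofFn fun i : Fin n => w i.succ := by simp [letters, Function.comp_def]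
    cases P with
    | nil =>
      rw [markedMak, this]
      simp [makTerm]
    | cons b P =>
      rw [markedMak, this, hl]
      simp [makTerm]

/-- The contribution to `mak` of the descent with top at position `i` and bottom at position `j`. -/
def descentTerm {n : ℕ} (w : Fin n → ℕ) (i j : Fin n) : ℕ :=
  1 + (∑ k : Fin n, if k < j ∧ w k < w i then 1 else 0)
    + ∑ k : Fin n, if j < k ∧ w k < w j then 1 else 0

theorem listMak_eq_sum {n : ℕ} (w : Fin n → ℕ) :
    listMak (List.ofFn w) = ∑ j : Fin n, ∑ i : Fin n,
      if (j : ℕ) = (i : ℕ) + 1 ∧ w j < w i then descentTerm w i j else 0 := by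
  rw [listMak, markedMak_eq_sum]
  refine Finset.sum_congr rfl fun j _ => ?_
  rw [List.append_nil]
  rcases hj : (j : ℕ) with _ | j'
  · rw [List.take_zero, List.reverse_nil, makTerm]
    exact (Finset.sum_eq_zero fun i _ => if_neg (by omega)).symm
  · have hlt : j' < n := by have := j.2; omega
    have hrev : ((List.ofFn w).take (j' + 1)).reverse
        = w ⟨j', hlt⟩ :: ((List.ofFn w).take j').reverse := by
      rw [List.take_add_one, List.getElem?_ofFn, dif_pos hlt]; simp
    have hcount := countP_take_ofFn w (fun b => decide (b < w ⟨j', hlt⟩)) (j' + 1)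
    rw [← List.countP_reverse, hrev] at hcount
    rw [hrev, makTerm, hcount, countP_drop_ofFn]
    refine Eq.symm ((Finset.sum_eq_single ⟨j', hlt⟩ ?_ (by simp)).trans ?_)
    · intro i _ hi
      refine if_neg fun h => hi (Fin.ext ?_)
      show (i : ℕ) = j'
      omega
    · refine if_congr (and_iff_right rfl) ?_ rfl
      rw [descentTerm]
      congr 1
      · congr 1
        refine Finset.sum_congr rfl fun k _ => if_congr ?_ rfl rfl
        rw [Fin.lt_def, hj, decide_eq_true_iff]
      · refine Finset.sum_congr rfl fun k _ => if_congr ?_ rfl rfl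
        rw [Fin.lt_def, hj, decide_eq_true_iff, Nat.succ_le_iff]

end Translation

/-! ### Embracing numbers and the pattern formula for `mak` -/

section Mak

variable {n : ℕ} {w : Fin n → ℕ}

theorem le_of_forall_isDescent {a b : Fin n} (h : ∀ i, a ≤ i → i < b → IsDescent w i)
    {s t : Fin n} (has : a ≤ s) (hst : s ≤ t) (htb : t ≤ b) : w t ≤ w s := by
  obtain ⟨t, ht⟩ := t
  induction t with
  | zero => exact (congrArg w (Fin.ext (by have := Fin.le_def.1 hst; simp at this ⊢; omega))).le
  | succ t ih =>
    rcases eq_or_lt_of_le hst with rfl | hlt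
    · exact le_rfl
    have h1 : s ≤ ⟨t, by omega⟩ := Fin.le_def.2 (Nat.lt_succ_iff.1 (Fin.lt_def.1 hlt))
    have h2 : (⟨t, by omega⟩ : Fin n) < b := lt_of_lt_of_le (Fin.lt_def.2 (Nat.lt_succ_self t)) htb
    obtain ⟨j, hj, hlt'⟩ := h _ (has.trans h1) h2
    have : j = ⟨t + 1, ht⟩ := Fin.ext hj
    rw [this] at hlt'
    exact hlt'.le.trans (ih _ h1 h2.le)

theorem exists_closer (t : Fin n) (ht : IsDescent w t) :
    ∃ a ≤ t, ¬ IsDescentBottom w a ∧ ∀ i, a ≤ i → i ≤ t → IsDescent w i := by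
  obtain ⟨t, hn⟩ := t
  induction t with
  | zero =>
    refine ⟨_, le_rfl, ?_, fun i h1 h2 => le_antisymm h1 h2 ▸ ht⟩
    rintro ⟨i, hi, -⟩
    simp at hi
  | succ t ih =>
    by_cases hb : IsDescentBottom w ⟨t + 1, hn⟩
    · obtain ⟨i, hi, hlt⟩ := hb
      have hi' : i = ⟨t, by omega⟩ := Fin.ext (by simpa using hi.symm)
      have hd : IsDescent w ⟨t, by omega⟩ := ⟨_, rfl, hi' ▸ hlt⟩
      obtain ⟨a, ha, hab, hall⟩ := ih _ hd
      refine ⟨a, ha.trans (Fin.le_def.2 (Nat.le_succ t)), hab, fun i h1 h2 => ?_⟩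
      rcases eq_or_lt_of_le h2 with rfl | h2
      · exact ht
      · exact hall i h1 (Fin.le_def.2 (Nat.lt_succ_iff.1 (Fin.lt_def.1 h2)))
    · exact ⟨_, le_rfl, hb, fun i h1 h2 => le_antisymm h1 h2 ▸ ht⟩

theorem exists_opener (j : Fin n) :
    ∃ b, j ≤ b ∧ ¬ IsDescent w b ∧ ∀ i, j ≤ i → i < b → IsDescent w i := by
  obtain ⟨d, hd⟩ : ∃ d, n = j + d := ⟨n - j, by omega⟩
  induction d generalizing j with
  | zero => have := j.2; omega
  | succ d ih =>
    by_cases hj : IsDescent w j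
    · obtain ⟨j', hj', hlt⟩ := id hj
      obtain ⟨b, h1, h2, h3⟩ := ih j' (by omega)
      refine ⟨b, le_trans (Fin.le_def.2 (by omega)) h1, h2, fun i hi hib => ?_⟩
      rcases eq_or_lt_of_le hi with rfl | hi
      · exact hj
      · exact h3 i (Fin.le_def.2 (by have := Fin.lt_def.1 hi; omega)) hib
    · exact ⟨j, le_rfl, hj, fun i h1 h2 => absurd h2 (not_lt.2 h1)⟩

/-- Each proper descent block that embraces a letter has exactly one descent across that letter. -/
theorem embracing_eq_card (hw : Function.Injective w) (i : Fin n) :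
    embracing w i = (Finset.univ.filter fun p : Fin n × Fin n =>
      (p.2 : ℕ) = (p.1 : ℕ) + 1 ∧ i < p.1 ∧ w p.2 < w i ∧ w i < w p.1).card := by
  apply le_antisymm
  · refine Finset.card_le_card_of_forall_subsingleton (fun p p' => p.1 ≤ p'.1 ∧ p'.2 ≤ p.2) ?_ ?_
    · rintro ⟨a, b⟩ hp
      simp only [Finset.mem_filter, Finset.mem_univ, true_and] at hp
      obtain ⟨⟨hab, hdes, ha, hb⟩, hia, hwa, hwb⟩ := hp
      classical
      -- The descent ends at the first letter of the block below `w i`.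
      have hex : ∃ k, ∃ h : k < n, a ≤ ⟨k, h⟩ ∧ w ⟨k, h⟩ < w i := ⟨b, b.2, hab.le, hwb⟩
      obtain ⟨hkn, hak, hwk⟩ := Nat.find_spec hex
      have hmin := fun m => Nat.find_min hex (m := m)
      have hkb : Nat.find hex ≤ b := Nat.find_min' hex ⟨b.2, hab.le, hwb⟩
      generalize Nat.find hex = k at *
      have hne : a ≠ ⟨k, hkn⟩ := by rintro rfl; omega
      have hlt : (a : ℕ) < k := Fin.lt_def.1 (lt_of_le_of_ne hak hne)
      obtain ⟨k', rfl⟩ : ∃ k', k = k' + 1 := ⟨k - 1, by omega⟩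
      have hak' : a ≤ ⟨k', by omega⟩ := Fin.le_def.2 (Nat.lt_succ_iff.1 hlt)
      have hik' : i < ⟨k', by omega⟩ := lt_of_lt_of_le hia hak'
      have hw' : w i < w ⟨k', by omega⟩ := by
        have h1 : ¬ w ⟨k', by omega⟩ < w i := fun h =>
          hmin k' (Nat.lt_succ_self _) ⟨by omega, hak', h⟩
        exact lt_of_le_of_ne (not_lt.1 h1) fun h => hik'.ne (hw h)
      refine ⟨(⟨k', by omega⟩, ⟨k' + 1, hkn⟩), ?_, hak', Fin.le_def.2 hkb⟩
      simp only [Finset.mem_filter, Finset.mem_univ, true_and]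
      exact ⟨hik', hwk, hw'⟩
    · rintro ⟨t, j⟩ hj ⟨a, b⟩ ⟨hab, h1⟩ ⟨a', b'⟩ ⟨hab', h1'⟩
      simp only [Finset.mem_filter, Finset.mem_univ, true_and] at hj hab hab'
      obtain ⟨htj, -⟩ := hj
      obtain ⟨⟨-, hdes, ha, hb⟩, -⟩ := hab
      obtain ⟨⟨-, hdes', ha', hb'⟩, -⟩ := hab'
      simp only [Fin.le_def] at h1 h1' hdes hdes'
      have key : ∀ a a' b : Fin n, (∀ i : Fin n, (a : ℕ) ≤ i → i < b → IsDescent w i) →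
          ¬ IsDescentBottom w a' → (a' : ℕ) ≤ b → ¬ a < a' := by
        intro a a' b hdes ha' hb hlt
        have := Fin.lt_def.1 hlt
        obtain ⟨c, hc, hcw⟩ := hdes ⟨(a' : ℕ) - 1, by omega⟩ (by simp; omega)
          (Fin.lt_def.2 (by simp; omega))
        have : c = a' := Fin.ext (by simp at hc; omega)
        subst this
        exact ha' ⟨_, by simp; omega, hcw⟩
      have haa : a = a' := le_antisymm (not_lt.1 (key a' a b' hdes' ha (by omega)))
        (not_lt.1 (key a a' b hdes ha' (by omega)))
      have hbb : b = b' := by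
        rcases lt_trichotomy b b' with h | h | h
        · exact absurd (hdes' b (by omega) h) hb
        · exact h
        · exact absurd (hdes b' (by omega) h) hb'
      rw [haa, hbb]
  · refine Finset.card_le_card_of_forall_subsingleton (fun p' p => p.1 ≤ p'.1 ∧ p'.2 ≤ p.2) ?_ ?_
    · rintro ⟨t, j⟩ hj
      simp only [Finset.mem_filter, Finset.mem_univ, true_and] at hj
      obtain ⟨htj, hit, hwj, hwt⟩ := hj
      obtain ⟨a, hat, hnb, hda⟩ := exists_closer t ⟨j, htj, hwj.trans hwt⟩
      obtain ⟨b, hjb, hnd, hdb⟩ := exists_opener (w := w) j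
      have hdes : ∀ i, a ≤ i → i < b → IsDescent w i := by
        intro i h1 h2
        rcases le_or_gt i t with h | h
        · exact hda i h1 h
        · exact hdb i (Fin.le_def.2 (by have := Fin.lt_def.1 h; omega)) h2
      have htb : t < b := lt_of_lt_of_le (Fin.lt_def.2 (by omega)) hjb
      refine ⟨(a, b), ?_, hat, hjb⟩
      simp only [Finset.mem_filter, Finset.mem_univ, true_and]
      refine ⟨⟨lt_of_le_of_lt hat htb, hdes, hnb, hnd⟩, ?_, ?_, ?_⟩
      · by_contra hia
        have := le_of_forall_isDescent hdes (not_lt.1 hia) hit.le htb.le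
        omega
      · exact hwt.le.trans (le_of_forall_isDescent hdes le_rfl hat htb.le)
      · refine lt_of_le_of_lt (le_of_forall_isDescent hdes ?_ hjb le_rfl) hwj
        exact hat.trans (Fin.le_def.2 (by omega))
    · rintro ⟨a, b⟩ hab ⟨t, j⟩ ⟨htj, h1⟩ ⟨t', j'⟩ ⟨htj', h1'⟩
      simp only [Finset.mem_filter, Finset.mem_univ, true_and] at hab htj htj'
      obtain ⟨⟨-, hdes, -, -⟩, -⟩ := hab
      have key : ∀ t j t' j' : Fin n, (j : ℕ) = t + 1 → (j' : ℕ) = t' + 1 → w j < w i →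
          w i < w t' → a ≤ t → j' ≤ b → ¬ t < t' := by
        intro t j t' j' hj hj' hwj hwt hat hjb hlt
        have := le_of_forall_isDescent hdes (s := j) (t := t')
          (hat.trans (Fin.le_def.2 (by omega))) (Fin.le_def.2 (by have := Fin.lt_def.1 hlt; omega))
          (le_trans (Fin.le_def.2 (by omega)) hjb)
        omega
      have htt : t = t' := le_antisymm
        (not_lt.1 (key t' j' t j htj'.1 htj.1 htj'.2.2.1 htj.2.2.2 h1'.1 h1.2))
        (not_lt.1 (key t j t' j' htj.1 htj'.1 htj.2.2.1 htj'.2.2.2 h1.1 h1'.2))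
      subst htt
      have : j = j' := Fin.ext (by omega)
      rw [this]

/-- The statistic `mak` of a permutation counts the patterns `1-32`, `2-31`, `32-1` and `21`. -/
theorem mak_eq_sum (hw : Function.Injective w) :
    mak w = ∑ j : Fin n, ∑ i : Fin n,
      if (j : ℕ) = (i : ℕ) + 1 ∧ w j < w i then descentTerm w i j else 0 := by
  have hD : Dbot w = ∑ j : Fin n, ∑ i : Fin n, if (j : ℕ) = (i : ℕ) + 1 ∧ w j < w i then
      1 + ∑ k : Fin n, (if w k < w j then 1 else 0) else 0 := by
    rw [Dbot, Finset.sum_filter]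
    refine Finset.sum_congr rfl fun j _ => ?_
    have hval : value w j = 1 + ∑ k : Fin n, (if w k < w j then 1 else 0) := by
      rw [value, Finset.card_filter, add_comm 1, Finset.card_eq_zero.2, add_zero]
      refine Finset.filter_eq_empty_iff.2 fun k _ h => h.1.ne (hw h.2)
    split_ifs with h
    · obtain ⟨i, hi, hlt⟩ := h
      rw [Finset.sum_eq_single i, if_pos ⟨hi, hlt⟩, hval]
      · intro i' _ hne
        exact if_neg fun h => hne (Fin.ext (by omega))
      · simp
    · exact (Finset.sum_eq_zero fun i _ => if_neg fun hi => h ⟨i, hi⟩).symm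
  have hR : Res w = ∑ j : Fin n, ∑ i : Fin n, if (j : ℕ) = (i : ℕ) + 1 ∧ w j < w i then
      ∑ k : Fin n, (if k < i ∧ w j < w k ∧ w k < w i then 1 else 0) else 0 := by
    rw [Res]
    simp_rw [embracing_eq_card hw, Finset.card_filter, Fintype.sum_prod_type_right]
    rw [Finset.sum_comm]
    refine Finset.sum_congr rfl fun j _ => ?_
    rw [Finset.sum_comm]
    refine Finset.sum_congr rfl fun i _ => ?_
    split_ifs with h
    · exact Finset.sum_congr rfl fun k _ => if_congr (by simp [h.1]) rfl rfl
    · refine Finset.sum_eq_zero fun k _ => if_neg fun hk => h ⟨hk.1, hk.2.2.1.trans hk.2.2.2⟩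
  rw [mak, hD, hR, ← Finset.sum_add_distrib]
  refine Finset.sum_congr rfl fun j _ => ?_
  rw [← Finset.sum_add_distrib]
  refine Finset.sum_congr rfl fun i _ => ?_
  split_ifs with h
  · rw [descentTerm, add_assoc, add_assoc, ← Finset.sum_add_distrib, ← Finset.sum_add_distrib]
    congr 1
    refine Finset.sum_congr rfl fun k _ => ?_
    have h1 : k = i ∨ k ≠ i ∧ w k ≠ w i := by
      by_cases hk : k = i
      · exact Or.inl hk
      · exact Or.inr ⟨hk, fun h => hk (hw h)⟩
    have h2 : k = j ∨ k ≠ j ∧ w k ≠ w j := by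
      by_cases hk : k = j
      · exact Or.inl hk
      · exact Or.inr ⟨hk, fun h => hk (hw h)⟩
    obtain ⟨hji, hlt⟩ := h
    simp only [Fin.lt_def, ne_eq, Fin.ext_iff] at h1 h2 ⊢
    rcases h1 with h1 | h1
    · have : w k = w i := by rw [Fin.ext h1]
      split_ifs <;> omega
    rcases h2 with h2 | h2
    · have : w k = w j := by rw [Fin.ext h2]
      split_ifs <;> omega
    split_ifs <;> omega
  · rfl

end Mak

/-! ### The one-line word of the inverse permutation -/

section PermWord

/-- The one-line word of `π⁻¹`. -/
def permWord {n : ℕ} (π : Equiv.Perm (Fin n)) : List ℕ := List.ofFn fun i => ((π⁻¹ i : Fin n) : ℕ)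

theorem permWord_perm {n : ℕ} (π : Equiv.Perm (Fin n)) : (permWord π).Perm (List.range n) := by
  refine (List.perm_ext_iff_of_nodup ?_ List.nodup_range).2 fun a => ?_
  · exact List.nodup_ofFn.2 fun i j h => π⁻¹.injective (Fin.ext h)
  · simp only [permWord, List.mem_ofFn', Set.mem_range, List.mem_range]
    constructor
    · rintro ⟨i, rfl⟩; exact Fin.is_lt _
    · intro ha; exact ⟨π ⟨a, ha⟩, by simp⟩

theorem permWord_injective (n : ℕ) : Function.Injective (permWord (n := n)) := by
  intro π σ h
  have := List.ofFn_injective h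
  rw [← inv_inj]
  exact Equiv.ext fun i => Fin.ext (congrFun this i)

theorem exists_permWord_eq {n : ℕ} {l : List ℕ} (h : l.Perm (List.range n)) :
    ∃ π : Equiv.Perm (Fin n), permWord π = l := by
  have hlen : l.length = n := by simpa using h.length_eq
  subst hlen
  have hlt : ∀ i : Fin l.length, l.get i < l.length := fun i => by
    have := (h.mem_iff (a := l.get i)).1 (List.get_mem l i)
    simpa using this
  have hinj : Function.Injective fun i : Fin l.length => (⟨l.get i, hlt i⟩ : Fin l.length) := by
    intro i j hij
    exact (h.nodup_iff.2 List.nodup_range).injective_get (Fin.mk.inj hij)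
  refine ⟨(Equiv.ofBijective _ (Finite.injective_iff_bijective.1 hinj))⁻¹, ?_⟩
  rw [permWord, inv_inv]
  exact List.ofFn_get l

theorem pair_sublist_or {l : List ℕ} {a b : ℕ} (ha : a ∈ l) (hb : b ∈ l) (hab : a ≠ b) :
    [a, b].Sublist l ∨ [b, a].Sublist l := by
  induction l with
  | nil => simp at ha
  | cons c l ih =>
    rcases List.mem_cons.1 ha with rfl | ha'
    · rcases List.mem_cons.1 hb with rfl | hb'
      · exact absurd rfl hab
      · exact Or.inl ((List.singleton_sublist.2 hb').cons_cons a)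
    · rcases List.mem_cons.1 hb with rfl | hb'
      · exact Or.inr ((List.singleton_sublist.2 ha').cons_cons b)
      · exact (ih ha' hb').imp (·.cons c) (·.cons c)

theorem pair_sublist_permWord {n : ℕ} (π : Equiv.Perm (Fin n)) (i j : Fin n) :
    [(i : ℕ), (j : ℕ)].Sublist (permWord π) ↔ π i < π j := by
  have fwd : ∀ i j : Fin n, [(i : ℕ), (j : ℕ)].Sublist (permWord π) → π i < π j := by
    intro i j h
    have hpw : (permWord π).Pairwise fun a b => ∀ (ha : a < n) (hb : b < n),
        π ⟨a, ha⟩ < π ⟨b, hb⟩ := by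
      rw [permWord, List.pairwise_ofFn]
      intro i j hij _ _
      simpa using hij
    exact (List.pairwise_iff_forall_sublist.1 hpw) h i.2 j.2
  refine ⟨fwd i j, fun h => ?_⟩
  have hmem : ∀ i : Fin n, (i : ℕ) ∈ permWord π := fun i => by
    rw [(permWord_perm π).mem_iff]; simp
  have hne : (i : ℕ) ≠ j := fun h' => by rw [Fin.ext h'] at h; exact lt_irrefl _ h
  exact (pair_sublist_or (hmem i) (hmem j) hne).resolve_right fun h' => lt_asymm h (fwd j i h')

theorem lrmax_eq_listLrmax {n : ℕ} (π : Equiv.Perm (Fin n)) :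
    lrmax π = listLrmax n (permWord π) := by
  rw [lrmax, listLrmax]
  refine Finset.card_bij (fun i _ => (i : ℕ)) ?_ (fun i _ j _ h => Fin.ext h) ?_
  · intro j hj
    simp only [Finset.mem_filter, Finset.mem_univ, true_and, Finset.mem_range] at hj ⊢
    exact ⟨j.2, fun i hi =>
      (pair_sublist_permWord π ⟨i, hi.trans j.2⟩ j).2 (hj _ (Fin.lt_def.2 hi))⟩
  · intro j hj
    simp only [Finset.mem_filter, Finset.mem_range] at hj
    refine ⟨⟨j, hj.1⟩, ?_, rfl⟩
    simp only [Finset.mem_filter, Finset.mem_univ, true_and]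
    exact fun i hi => (pair_sublist_permWord π i ⟨j, hj.1⟩).1 (hj.2 i (Fin.lt_def.1 hi))

theorem inv_inv_eq {n : ℕ} (π : Equiv.Perm (Fin n)) : inv π = inv ⇑π⁻¹ := by
  rw [inv, inv]
  refine Finset.card_bij (fun p _ => (π p.2, π p.1)) ?_ ?_ ?_
  · intro p hp
    simp only [Finset.mem_filter, Finset.mem_univ, true_and] at hp ⊢
    simpa using hp.symm
  · intro p _ p' _ h
    obtain ⟨h1, h2⟩ := Prod.mk.inj h
    exact Prod.ext (π.injective h2) (π.injective h1)
  · intro p hp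
    simp only [Finset.mem_filter, Finset.mem_univ, true_and] at hp
    exact ⟨(π⁻¹ p.2, π⁻¹ p.1), by simpa using hp.symm, by simp⟩

theorem inv_eq_listInv_permWord {n : ℕ} (π : Equiv.Perm (Fin n)) :
    inv π = listInv (permWord π) := by
  rw [inv_inv_eq, permWord, ← inv_eq_listInv]
  simp only [inv, Fin.lt_def]

theorem iinvr_eq_revInvr_permWord {n : ℕ} (s : ℕ) (π : Equiv.Perm (Fin n)) :
    iinvr (s + 1) π = revInvr s (permWord π).reverse := by
  rw [iinvr, permWord, ← invr_eq_revInvr]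
  simp only [invr, Fin.lt_def]

theorem imaj_eq_iinvr {n : ℕ} (π : Equiv.Perm (Fin n)) : imaj π = iinvr 1 π := by
  rw [imaj, iinvr, maj, invr, Finset.card_eq_zero.2, zero_add]
  · rfl
  · refine Finset.filter_eq_empty_iff.2 fun p _ h => ?_
    have := Fin.lt_def.1 h.1
    omega

theorem imak_eq_listMak_permWord {n : ℕ} (π : Equiv.Perm (Fin n)) :
    imak π = listMak (permWord π) := by
  have hinj : Function.Injective fun i => ((π⁻¹ i : Fin n) : ℕ) :=
    fun i j h => π⁻¹.injective (Fin.ext h)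
  rw [permWord, listMak_eq_sum, ← mak_eq_sum hinj, imak]
  simp only [mak, Dbot, Res, value, embracing, IsProperDescentBlock, IsDescent, IsDescentBottom,
    Fin.lt_def, Fin.le_def, Fin.ext_iff]
  congr 1

end PermWord

/-! ### Permutations that come from set partitions -/

section SetPartitions

/-- The list of nonempty words `L` displays a set partition: each block is increasing, and so are
the maxima of the blocks. -/
def BlocksSorted {β : Type*} [LinearOrder β] (L : List (List β)) : Prop :=
  (∀ B ∈ L, B.Pairwise (· < ·)) ∧ L.Pairwise fun B C => ∃ c ∈ C, ∀ b ∈ B, b < c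

theorem blocks_pairwise {n : ℕ} (σ : Finpartition (Finset.univ : Finset (Fin n))) :
    (blocks σ).Pairwise fun B C => ∃ c ∈ C, ∀ b ∈ B, b < c := by
  rw [blocks, List.pairwise_map]
  refine ((List.pairwise_lt_finRange n).filter _).imp_of_mem ?_
  intro i j hi _ hij
  rw [List.mem_filter] at hi
  have hi' := of_decide_eq_true hi.2
  exact ⟨j, σ.mem_part_self.2 (Finset.mem_univ j), fun b hb => (hi' b hb).trans_lt hij⟩

theorem mem_blocks {n : ℕ} {σ : Finpartition (Finset.univ : Finset (Fin n))}
    {B : Finset (Fin n)} : B ∈ blocks σ ↔ B ∈ σ.parts := by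
  rw [blocks, List.mem_map]
  constructor
  · rintro ⟨i, -, rfl⟩
    exact σ.part_mem.2 (Finset.mem_univ i)
  · intro hB
    have hne := σ.nonempty_of_mem_parts hB
    have hp := σ.part_eq_of_mem hB (B.max'_mem hne)
    refine ⟨B.max' hne, ?_, hp⟩
    rw [List.mem_filter]
    exact ⟨List.mem_finRange _, decide_eq_true fun j hj => B.le_max' j (hp ▸ hj)⟩

theorem mem_Pperm_iff {n : ℕ} (α : Composition n) (π : Equiv.Perm (Fin n)) :
    π ∈ Pperm α ↔ ∃ L : List (List (Fin n)), L.map List.length = α.blocks ∧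
      L.flatten = List.ofFn π ∧ BlocksSorted L := by
  rw [Pperm, Finset.mem_filter, and_iff_right (Finset.mem_univ π)]
  constructor
  · rintro ⟨σ, hshape, hσ⟩
    refine ⟨(blocks σ).map fun B => B.sort (· ≤ ·), ?_, ?_, ?_, ?_⟩
    · rw [← hshape, shape, List.map_map]
      exact List.map_congr_left fun B _ => Finset.length_sort _
    · exact hσ.symm
    · intro B hB
      obtain ⟨C, -, rfl⟩ := List.mem_map.1 hB
      exact (Finset.sortedLT_sort C).pairwise
    · rw [List.pairwise_map]
      refine (blocks_pairwise σ).imp ?_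
      rintro B C ⟨c, hc, h⟩
      exact ⟨c, (Finset.mem_sort _).2 hc, fun b hb => h b ((Finset.mem_sort _).1 hb)⟩
  · rintro ⟨L, hlen, hflat, hinc, hmax⟩
    have hnd : L.flatten.Nodup := hflat ▸ List.nodup_ofFn.2 π.injective
    have hne : ∀ B ∈ L, B ≠ [] := by
      rintro _ hB rfl
      have : (0 : ℕ) ∈ α.blocks := hlen ▸ List.mem_map_of_mem (f := List.length) hB
      exact absurd (α.blocks_pos this) (lt_irrefl 0)
    have hcover : ∀ a : Fin n, ∃ B ∈ L, a ∈ B := fun a => by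
      have : a ∈ L.flatten := by
        rw [hflat, List.mem_ofFn']; exact π.surjective a
      exact List.mem_flatten.1 this
    have hdisj : ∀ a : Fin n, ∀ B ∈ L, ∀ C ∈ L, a ∈ B → a ∈ C → B = C := by
      intro a B hB C hC haB haC
      by_contra hBC
      have : Std.Symm (List.Disjoint (α := Fin n)) := ⟨fun _ _ h => h.symm⟩
      exact (List.nodup_flatten.1 hnd).2.forall hB hC hBC haB haC
    let σ : Finpartition (Finset.univ : Finset (Fin n)) :=
      Finpartition.ofExistsUnique (L.map List.toFinset).toFinset
        (fun _ _ => Finset.subset_univ _)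
        (fun a _ => by
          obtain ⟨B, hB, ha⟩ := hcover a
          refine ⟨B.toFinset, ⟨?_, List.mem_toFinset.2 ha⟩, ?_⟩
          · exact List.mem_toFinset.2 (List.mem_map_of_mem hB)
          · rintro C ⟨hC, haC⟩
            obtain ⟨C', hC', rfl⟩ := List.mem_map.1 (List.mem_toFinset.1 hC)
            rw [hdisj a C' hC' B hB (List.mem_toFinset.1 haC) ha])
        (fun h => by
          obtain ⟨B, hB, h⟩ := List.mem_map.1 (List.mem_toFinset.1 h)
          exact hne B hB (List.toFinset_eq_empty_iff B |>.1 h))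
    have hparts : ∀ B, B ∈ σ.parts ↔ B ∈ L.map List.toFinset := fun B => List.mem_toFinset
    have hirr : ∀ B : Finset (Fin n), ¬ ∃ c ∈ B, ∀ b ∈ B, b < c := fun B ⟨c, hc, h⟩ =>
      lt_irrefl c (h c hc)
    have hmax' : (L.map List.toFinset).Pairwise fun B C => ∃ c ∈ C, ∀ b ∈ B, b < c := by
      rw [List.pairwise_map]
      refine hmax.imp ?_
      rintro B C ⟨c, hc, h⟩
      exact ⟨c, List.mem_toFinset.2 hc, fun b hb => h b (List.mem_toFinset.1 hb)⟩
    have hnodup : ∀ {M : List (Finset (Fin n))},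
        M.Pairwise (fun B C => ∃ c ∈ C, ∀ b ∈ B, b < c) → M.Nodup := fun h =>
      List.Pairwise.imp (S := (· ≠ ·)) (fun {B C} h' hBC => hirr B (by subst hBC; exact h')) h
    have hblocks : blocks σ = L.map List.toFinset := by
      refine List.Perm.eq_of_pairwise ?_ (blocks_pairwise σ) hmax'
        ((List.perm_ext_iff_of_nodup (hnodup (blocks_pairwise σ)) (hnodup hmax')).2
          fun B => mem_blocks.trans (hparts B))
      rintro B C - - ⟨c, hc, h⟩ ⟨b, hb, h'⟩
      exact absurd (h b hb) (lt_asymm (h' c hc))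
    have hBnd : ∀ B ∈ L, B.Nodup := fun B hB => (List.nodup_flatten.1 hnd).1 B hB
    refine ⟨σ, ?_, ?_⟩
    · rw [shape, hblocks, List.map_map, ← hlen]
      exact List.map_congr_left fun B hB => List.toFinset_card_of_nodup (hBnd B hB)
    · rw [eraseBars, hblocks, List.map_map, ← hflat]
      conv_lhs => rw [← List.map_id L]
      congr 1
      refine List.map_congr_left fun B hB => ?_
      exact (((List.toFinset_sort (r := (· ≤ ·)) (hBnd B hB)).2
        ((hinc B hB).imp fun h => h.le))).symm

/-- The word `f N, f (N + 1), …` cut into blocks of the sizes `bs`. -/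
def cut (f : ℕ → ℕ) : ℕ → List ℕ → List (List ℕ)
  | _, [] => []
  | N, c :: bs => (List.range' N c).map f :: cut f (N + c) bs

theorem cut_append (f : ℕ → ℕ) (N : ℕ) (bs : List ℕ) (c : ℕ) :
    cut f N (bs ++ [c]) = cut f N bs ++ [(List.range' (N + bs.sum) c).map f] := by
  induction bs generalizing N with
  | nil => simp [cut]
  | cons b bs ih => simp [cut, ih, add_assoc]

theorem cut_flatten (f : ℕ → ℕ) (N : ℕ) (bs : List ℕ) :
    (cut f N bs).flatten = (List.range' N bs.sum).map f := by
  induction bs generalizing N with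
  | nil => simp [cut]
  | cons b bs ih => simp [cut, ih, ← List.map_append]

theorem eq_cut (f : ℕ → ℕ) (N : ℕ) (L : List (List ℕ))
    (h : L.flatten = (List.range' N (L.map List.length).sum).map f) :
    L = cut f N (L.map List.length) := by
  induction L generalizing N with
  | nil => rfl
  | cons B L ih =>
    rw [List.map_cons, List.sum_cons, List.flatten_cons, ← List.range'_append_1,
      List.map_append] at h
    obtain ⟨h1, h2⟩ := List.append_inj h (by simp)
    rw [List.map_cons, cut, ← ih _ h2, ← h1]

/-- The last positions of the blocks of sizes `bs`. -/
def blockEnds (bs : List ℕ) : Set ℕ := {k | ∃ bs', bs' <+: bs ∧ bs'.sum = k + 1}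

theorem lt_sum_of_mem_blockEnds {bs : List ℕ} {k : ℕ} (h : k ∈ blockEnds bs) : k < bs.sum := by
  obtain ⟨bs', ⟨t, rfl⟩, hs⟩ := h
  rw [List.sum_append]; omega

theorem mem_blockEnds_append {bs : List ℕ} {c k : ℕ} :
    k ∈ blockEnds (bs ++ [c]) ↔ k ∈ blockEnds bs ∨ bs.sum + c = k + 1 := by
  constructor
  · rintro ⟨bs', h, hs⟩
    rcases List.prefix_concat_iff.1 h with rfl | h
    · right; simpa using hs
    · exact Or.inl ⟨bs', h, hs⟩
  · rintro (⟨bs', h, hs⟩ | h)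
    · exact ⟨bs', h.trans (List.prefix_append _ _), hs⟩
    · exact ⟨_, List.prefix_refl _, by simpa using h⟩

theorem last_mem_blockEnds {bs : List ℕ} (h : bs.sum ≠ 0) : bs.sum - 1 ∈ blockEnds bs :=
  ⟨bs, List.prefix_refl _, by omega⟩

theorem blocksSorted_cut (f : ℕ → ℕ) (bs : List ℕ) (hbs : ∀ c ∈ bs, 0 < c) :
    BlocksSorted (cut f 0 bs) ↔
      (∀ i, i + 1 < bs.sum → i ∉ blockEnds bs → f i < f (i + 1)) ∧
        ∀ e < bs.sum, e ∈ blockEnds bs → ∀ i < e, f i < f e := by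
  induction bs using List.reverseRecOn with
  | nil => simp [cut, BlocksSorted]
  | append_singleton bs c ih =>
    have hc : 0 < c := hbs c (by simp)
    have hsum : (bs ++ [c]).sum = bs.sum + c := by simp
    have hcut := cut_append f 0 bs c
    rw [zero_add] at hcut
    have hflat := cut_flatten f 0 bs
    set N := bs.sum with hN
    -- The condition on the last block alone, and on the position of its maximum.
    have key : BlocksSorted (cut f 0 (bs ++ [c])) ↔ BlocksSorted (cut f 0 bs) ∧
        (∀ i, N ≤ i → i + 1 < N + c → f i < f (i + 1)) ∧ ∀ i < N + c - 1, f i < f (N + c - 1) := by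
      have hsort : ((List.range' N c).map f).Pairwise (· < ·) ↔
          ∀ i, N ≤ i → i + 1 < N + c → f i < f (i + 1) := by
        rw [List.pairwise_map]
        constructor
        · intro h i h1 h2
          have : [i, i + 1].Sublist (List.range' N c) := by
            obtain ⟨d, rfl⟩ := Nat.exists_eq_add_of_le h1
            obtain ⟨d', rfl⟩ : ∃ d', c = d + (2 + d') := ⟨c - (d + 2), by omega⟩
            rw [← List.range'_append_1, ← List.range'_append_1]
            exact (List.sublist_append_left _ _).trans (List.sublist_append_right _ _)
          exact List.pairwise_iff_forall_sublist.1 h this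
        · intro h
          refine (List.pairwise_lt_range' (s := N) (n := c)).imp_of_mem ?_
          intro i j hi hj hij
          rw [List.mem_range'_1] at hi hj
          obtain ⟨d, rfl⟩ : ∃ d, j = i + 1 + d := ⟨j - (i + 1), by omega⟩
          induction d with
          | zero => exact h i hi.1 hj.2
          | succ d ihd =>
            exact (ihd ⟨by omega, by omega⟩ (by omega)).trans (h (i + 1 + d) (by omega) (by omega))
      rw [hcut, BlocksSorted, BlocksSorted, List.pairwise_append]
      simp only [List.mem_append, List.mem_singleton]
      constructor
      · rintro ⟨h1, h2, -, h3⟩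
        have hB := h1 _ (Or.inr rfl)
        refine ⟨⟨fun B hB => h1 B (Or.inl hB), h2⟩, hsort.1 hB, fun i hi => ?_⟩
        -- The last letter is the maximum of the last block.
        have hlast : ∀ j, N ≤ j → j ≤ N + c - 1 → f j ≤ f (N + c - 1) := by
          intro j hj hj'
          obtain ⟨d, hd⟩ : ∃ d, N + c - 1 = j + d := ⟨N + c - 1 - j, by omega⟩
          have hch : ∀ d', j + d' < N + c → f j ≤ f (j + d') := by
            intro d' hd'
            induction d' with
            | zero => exact le_rfl
            | succ d' ih' =>
              exact (ih' (by omega)).trans (hsort.1 hB (j + d') (by omega) (by omega)).le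
          rw [hd]
          exact hch d (by omega)
        by_cases hiN : i < N
        · have hfi : f i ∈ (cut f 0 bs).flatten := by
            rw [hflat]; exact List.mem_map_of_mem (List.mem_range'_1.2 (by omega))
          obtain ⟨C, hC, hfC⟩ := List.mem_flatten.1 hfi
          obtain ⟨x, hx, hlt⟩ := h3 C hC _ rfl
          obtain ⟨j, hj, rfl⟩ := List.mem_map.1 hx
          rw [List.mem_range'_1] at hj
          exact (hlt _ hfC).trans_le (hlast j hj.1 (by omega))
        · exact (hsort.1 hB i (by omega) (by omega)).trans_le (hlast (i + 1) (by omega) (by omega))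
      · rintro ⟨⟨h1, h2⟩, h3, h4⟩
        refine ⟨?_, h2, List.pairwise_singleton _ _, ?_⟩
        · rintro B (hB | rfl)
          · exact h1 B hB
          · exact hsort.2 h3
        · rintro C hC B rfl
          refine ⟨f (N + c - 1), List.mem_map_of_mem (List.mem_range'_1.2 (by omega)), ?_⟩
          intro b hb
          have : b ∈ (cut f 0 bs).flatten := List.mem_flatten.2 ⟨C, hC, hb⟩
          rw [hflat] at this
          obtain ⟨i, hi, rfl⟩ := List.mem_map.1 this
          rw [List.mem_range'_1] at hi
          exact h4 i (by omega)
    rw [key, ih fun b hb => hbs b (by simp [hb]), hsum]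
    have hends : ∀ k, k ∈ blockEnds (bs ++ [c]) ↔ k ∈ blockEnds bs ∨ N + c = k + 1 := fun k =>
      mem_blockEnds_append
    constructor
    · rintro ⟨⟨h1, h2⟩, h3, h4⟩
      refine ⟨fun i hi hT => ?_, fun e he hT i hi => ?_⟩
      · rw [hends, not_or] at hT
        rcases lt_trichotomy (i + 1) N with h | h | h
        · exact h1 i h hT.1
        · exact absurd (by rw [show i = bs.sum - 1 by omega]; exact last_mem_blockEnds (by omega))
            hT.1
        · exact h3 i (by omega) hi
      · rcases (hends e).1 hT with hT | hT
        · exact h2 e (lt_sum_of_mem_blockEnds hT) hT i hi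
        · obtain rfl : e = N + c - 1 := by omega
          exact h4 i hi
    · rintro ⟨h1, h2⟩
      refine ⟨⟨fun i hi hT => ?_, fun e he hT i hi => ?_⟩, fun i hi hic => ?_, fun i hi => ?_⟩
      · refine h1 i (by omega) fun h => ?_
        rcases (hends i).1 h with h | h
        · exact hT h
        · omega
      · exact h2 e (by omega) ((hends e).2 (Or.inl hT)) i hi
      · refine h1 i (by omega) fun h => ?_
        rcases (hends i).1 h with h | h
        · have := lt_sum_of_mem_blockEnds h; omega
        · omega
      · exact h2 _ (by omega) ((hends _).2 (Or.inr (by omega))) i hi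

theorem blocksSorted_map_val {n : ℕ} (L : List (List (Fin n))) :
    BlocksSorted (L.map (List.map Fin.val)) ↔ BlocksSorted L := by
  simp [BlocksSorted, List.pairwise_map]

theorem mem_Pperm_iff_adm {n : ℕ} (α : Composition n) (π : Equiv.Perm (Fin n)) :
    π ∈ Pperm α ↔ Adm (blockEnds α.blocks) n (permWord π) := by
  let f : ℕ → ℕ := fun i => if h : i < n then π ⟨i, h⟩ else 0
  have hf : ∀ i (h : i < n), f i = π ⟨i, h⟩ := fun i h => dif_pos h
  have hword : (List.ofFn π).map Fin.val = (List.range' 0 n).map f := by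
    refine List.ext_getElem (by simp) fun i h1 h2 => ?_
    have hi : i < n := by simpa using h2
    simp [hf i hi]
  have hcut : ∀ L : List (List (Fin n)), L.map List.length = α.blocks → L.flatten = List.ofFn π →
      L.map (List.map Fin.val) = cut f 0 α.blocks := by
    intro L hlen hflat
    have hl : (L.map (List.map Fin.val)).map List.length = α.blocks := by
      rw [← hlen, List.map_map]; exact List.map_congr_left fun B _ => by simp
    have := eq_cut f 0 (L.map (List.map Fin.val)) (by
      rw [hl, α.blocks_sum, ← hword, ← hflat, List.map_flatten])
    rwa [hl] at this
  have hP : π ∈ Pperm α ↔ BlocksSorted (cut f 0 α.blocks) := by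
    rw [mem_Pperm_iff]
    constructor
    · rintro ⟨L, hlen, hflat, h⟩
      rw [← hcut L hlen hflat]
      exact (blocksSorted_map_val L).2 h
    · intro h
      have hlen := List.map_length_splitWrtCompositionAux (ns := α.blocks) (l := List.ofFn π)
        (by simp)
      have hflat := List.flatten_splitWrtCompositionAux (ns := α.blocks) (l := List.ofFn π)
        (by simp)
      refine ⟨_, hlen, hflat, ?_⟩
      rw [← blocksSorted_map_val, hcut _ hlen hflat]
      exact h
  rw [hP, blocksSorted_cut f _ fun c hc => α.blocks_pos hc, α.blocks_sum, Adm]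
  have hlt : ∀ i j (hi : i < n) (hj : j < n), f i < f j ↔ [i, j].Sublist (permWord π) := by
    intro i j hi hj
    rw [hf i hi, hf j hj, ← Fin.lt_def]
    exact (pair_sublist_permWord π ⟨i, hi⟩ ⟨j, hj⟩).symm
  refine and_congr (forall₃_congr fun i hi _ => hlt _ _ (by omega) hi)
    (forall₃_congr fun e he _ => forall₂_congr fun i hi => hlt _ _ (by omega) he)

end SetPartitions

/-! ### Sums over the permutations of a given shape -/

section Final

variable {R : Type*} [CommRing R]

open Classical in
theorem sum_Pperm {n : ℕ} (α : Composition n) (F : List ℕ → R) :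
    ∑ π ∈ Pperm α, F (permWord π)
      = ∑ l ∈ (permLists n).filter (Adm (blockEnds α.blocks) n), F l := by
  refine Finset.sum_bij (fun π _ => permWord π) ?_ ?_ ?_ fun _ _ => rfl
  · intro π hπ
    exact Finset.mem_filter.2 ⟨mem_permLists.2 (permWord_perm π), (mem_Pperm_iff_adm α π).1 hπ⟩
  · intro π _ σ _ h
    exact permWord_injective n h
  · intro l hl
    obtain ⟨h1, h2⟩ := Finset.mem_filter.1 hl
    obtain ⟨π, rfl⟩ := exists_permWord_eq (mem_permLists.1 h1)
    exact ⟨π, (mem_Pperm_iff_adm α π).2 h2, rfl⟩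

theorem sum_inv_eq_sum_iinvr {n : ℕ} (α : Composition n) (s : ℕ) (q x : R) :
    ∑ π ∈ Pperm α, q ^ inv π * x ^ lrmax π = ∑ π ∈ Pperm α, q ^ iinvr (s + 1) π * x ^ lrmax π := by
  simp_rw [inv_eq_listInv_permWord, listInv_eq_revInv, iinvr_eq_revInvr_permWord,
    lrmax_eq_listLrmax]
  rw [sum_Pperm α fun l => q ^ revInv l.reverse * x ^ listLrmax n l,
    sum_Pperm α fun l => q ^ revInvr s l.reverse * x ^ listLrmax n l, sum_revInv_eq_sum_revInvr]

theorem sum_inv_eq_sum_imak {n : ℕ} (α : Composition n) (q x : R) :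
    ∑ π ∈ Pperm α, q ^ inv π * x ^ lrmax π = ∑ π ∈ Pperm α, q ^ imak π * x ^ lrmax π := by
  simp_rw [inv_eq_listInv_permWord, imak_eq_listMak_permWord, lrmax_eq_listLrmax]
  rw [sum_Pperm α fun l => q ^ listInv l * x ^ listLrmax n l,
    sum_Pperm α fun l => q ^ listMak l * x ^ listLrmax n l, sum_listMak_eq_sum_listInv]
  rcases Nat.eq_zero_or_pos n with h | h
  · exact Or.inl h
  · have := last_mem_blockEnds (bs := α.blocks) (by rw [α.blocks_sum]; omega)
    rw [α.blocks_sum] at this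
    exact Or.inr this

end Final

end SetPartPerm

theorem theorem4p2 (n : ℕ) (α : Composition n) (r : ℕ) (hr : 1 ≤ r) :
    (SetPartPerm.genPoly α (fun π => SetPartPerm.inv ⇑π)
        = SetPartPerm.genPoly α SetPartPerm.imaj ∧
      SetPartPerm.genPoly α SetPartPerm.imaj
        = SetPartPerm.genPoly α SetPartPerm.imak ∧
      SetPartPerm.genPoly α SetPartPerm.imak
        = SetPartPerm.genPoly α (SetPartPerm.iinvr r)) ∧
    (SetPartPerm.genPolyLrmax α (fun π => SetPartPerm.inv ⇑π)
        = SetPartPerm.genPolyLrmax α SetPartPerm.imaj ∧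
      SetPartPerm.genPolyLrmax α SetPartPerm.imaj
        = SetPartPerm.genPolyLrmax α SetPartPerm.imak ∧
      SetPartPerm.genPolyLrmax α SetPartPerm.imak
        = SetPartPerm.genPolyLrmax α (SetPartPerm.iinvr r)) := by
  obtain ⟨s, rfl⟩ : ∃ s, r = s + 1 := ⟨r - 1, by omega⟩
  have hmaj : SetPartPerm.imaj (n := n) = SetPartPerm.iinvr (0 + 1) :=
    funext SetPartPerm.imaj_eq_iinvr
  have h1 : ∀ t, SetPartPerm.genPoly α (fun π => SetPartPerm.inv ⇑π)
      = SetPartPerm.genPoly α (SetPartPerm.iinvr (t + 1)) := fun t => by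
    simpa [SetPartPerm.genPoly] using
      SetPartPerm.sum_inv_eq_sum_iinvr α t (Polynomial.X : Polynomial ℤ) 1
  have h2 : SetPartPerm.genPoly α (fun π => SetPartPerm.inv ⇑π)
      = SetPartPerm.genPoly α SetPartPerm.imak := by
    simpa [SetPartPerm.genPoly] using
      SetPartPerm.sum_inv_eq_sum_imak α (Polynomial.X : Polynomial ℤ) 1
  have h3 : ∀ t, SetPartPerm.genPolyLrmax α (fun π => SetPartPerm.inv ⇑π)
      = SetPartPerm.genPolyLrmax α (SetPartPerm.iinvr (t + 1)) := fun t =>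
    SetPartPerm.sum_inv_eq_sum_iinvr α t _ _
  have h4 : SetPartPerm.genPolyLrmax α (fun π => SetPartPerm.inv ⇑π)
      = SetPartPerm.genPolyLrmax α SetPartPerm.imak := SetPartPerm.sum_inv_eq_sum_imak α _ _
  rw [hmaj]
  exact ⟨⟨h1 0, (h1 0).symm.trans h2, h2.symm.trans (h1 s)⟩,
    h3 0, (h3 0).symm.trans h4, h4.symm.trans (h3 s)⟩
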